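/- Let $G=\mathrm{PSL}(2,\mathbb R)$ and let $\Gamma\le G$ be a discrete subgroup such that $X=\Gamma\backslash G$ is compact. Write $a_t,b_s,c_u,d_\pi\in G$ for the classes of the matrices $$\begin{pmatrix}e^{t/2}&0\\0&e^{-t/2}\end{pmatrix},\quad \begin{pmatrix}1&s\\0&1\end{pmatrix},\quad \begin{pmatrix}1&0\\u&1\end{pmatrix},\quad \begin{pmatrix}0&1\\-1&0\end{pmatrix}.$$ The flow on $X$ is $\varphi_t(\Gamma g)=\Gamma ga_t$ and time reversal is $\mathcal T(\Gamma g)=\Gamma gd_\pi$. Let $d_G$ be the distance on $G$ of the left-invariant Riemannian metric given by $\langle A,B\rangle=\mathrm{tr}(A^{\mathsf T}B)$ on $\mathfrak{sl}(2,\mathbb R)$, and let $d_X(x,y)=\inf\{d_G(g,h):\Gamma g=x,\ \Gamma h=y\}$. For $x=\Gamma g$ we write $z=(u,s)_x\in\mathcal P_\varepsilon(x)$ if $z=\Gamma gc_ub_s$ and $|u|,|s|<\varepsilon$. A $T$-periodic orbit is an orbit $\{\varphi_t(x):t\in\mathbb R\}$ with $\varphi_T(x)=x$, $T>0$ ($T$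 need not be the least period). A $T$-periodic orbit $c$ and a $T'$-periodic orbit $c'$ are called $\varepsilon$-partner orbits of each other if there are $L\ge2$, $0=t_0<\dots<t_L=T$, $0=t_0'<\dots<t_L'=T'$, a permutation $\sigma$ of $\{0,\dots,L-1\}$ and points $x\in c$, $x'\in c'$ such that for each $j$ either $d_X(\varphi_{t+t_j}(x),\varphi_{t+t'_{\sigma(j)}}(x'))<\varepsilon$ for all $t\in[0,t_{j+1}-t_j]$, or $d_X(\varphi_{t+t_j}(x),\varphi_{t-t'_{\sigma(j)+1}}(\mathcal T(x')))<\varepsilon$ for all $t\in[0,t_{j+1}-t_j]$. Then there is a constant $\varepsilon_*>0$, depending only on $\Gamma$, with the following two properties. (i) (Expansivity.) If $0<\varepsilon<\varepsilon_*$ and $x_1,x_2\in X$ satisfy $\varphi_{T_1}(x_1)=x_1$, $\varphi_{T_2}(x_2)=x_2$ with $T_1,T_2>0$, $|T_1-T_2|\le\sqrt2\,\varepsilon$ and $d_X(\varphi_t(x_1),\varphi_t(x_2))<\varepsilon$ for all $t\in[0,\min\{T_1,T_2\}]$, then $T_1=T_2$ and the orbits of $x_1$ and $x_2$ coincide. (ii)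 Let $\sigma_0>0$ be any number with $d_G(\gamma g,g)>\sigma_0$ for all $\gamma\in\Gamma\setminus\{e\}$ and $g\in G$, let $0<\varepsilon<\sigma_0/24$, and let $c$ be a $T$-periodic orbit having two serial $(2,\varepsilon)$-antiparallel encounters: there are $x,y,z,w\in c$ and $T_1,T_2,T_3,T_4>0$ with $T_1+T_2+T_3+T_4=T$, $\varphi_{T_1}(x)=y$, $\varphi_{T_2}(y)=z$, $\varphi_{T_3}(z)=w$, $\varphi_{T_4}(w)=x$, and $\mathcal T(z)=(u_1,s_1)_y\in\mathcal P_\varepsilon(y)$, $\mathcal T(w)=(u_2,s_2)_x\in\mathcal P_\varepsilon(x)$. Assume $$|u_1|>6\varepsilon e^{-T_2},\qquad |s_1|>30\varepsilon^3+13\varepsilon e^{-T_1}+5\varepsilon e^{-T_2}+3\varepsilon e^{-T_3}.$$ Then there is a $T'$-periodic orbit $c'$ which is a $20\varepsilon$-partner orbit of $c$ and differs from $c$ in both encounters, in the following sense: there are $v\in c'$ and $r_1,r_2,r_3,r_4>0$ with $r_2+r_1+r_4+r_3=T'$ and $|r_j-T_j|<20\varepsilon$ for $j=1,2,3,4$,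 such that $$d_X(\varphi_t(y),\varphi_t(v))<20\varepsilon\ (0\le t\le T_2),\qquad d_X(\varphi_t(x),\varphi_t(\mathcal T(\varphi_{r_2+r_1}(v))))<20\varepsilon\ (0\le t\le T_1),$$ $$d_X(\varphi_t(w),\varphi_t(\varphi_{r_2+r_1}(v)))<20\varepsilon\ (0\le t\le T_4),\qquad d_X(\varphi_t(z),\varphi_t(\mathcal T(\varphi_{T'}(v))))<20\varepsilon\ (0\le t\le T_3);$$ that is, $c'$ follows the stretch $y\to z$ forwards, $x\to y$ backwards, $w\to x$ forwards and $z\to w$ backwards, in this order. Moreover $c'$ meets $\mathcal P_{6\varepsilon}(y)$ in a point different from $y$ and from $\mathcal T(z)$, and $$\Big|\frac{T'-T}{2}-\ln\big((1+u_1s_1)(1+u_2s_2)\big)\Big|<\varepsilon^2\big(21e^{-T_1}+30e^{-T_2}+12e^{-T_3}+19e^{-T_4}\big).$$ If in addition $\varepsilon<\varepsilon_*/40$, then the partner is unique: every $T''$-periodic orbit $c''$ that differs from $c$ in both encounters in the above sense (with $T''$ in place of $T'$) satisfies $c''=c'$ and $T''=T'$. -/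

import Mathlib

open scoped MatrixGroups

noncomputable section

namespace HadamardGutzwiller

/-- The group `PSL(2,ℝ)`, with the quotient topology of `SL(2,ℝ)`. -/
abbrev G : Type := Matrix.ProjectiveSpecialLinearGroup (Fin 2) ℝ

/-- The matrix `diag(e^{t/2}, e^{-t/2})`. -/
def matA (t : ℝ) : SL(2, ℝ) :=
  ⟨!![Real.exp (t / 2), 0; 0, Real.exp (-(t / 2))], by
    rw [Matrix.det_fin_two_of, ← Real.exp_add]; simp⟩

/-- The upper triangular unipotent matrix with entry `s`. -/
def matB (s : ℝ) : SL(2, ℝ) :=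
  ⟨!![1, s; 0, 1], by rw [Matrix.det_fin_two_of]; simp⟩

/-- The lower triangular unipotent matrix with entry `u`. -/
def matC (u : ℝ) : SL(2, ℝ) :=
  ⟨!![1, 0; u, 1], by rw [Matrix.det_fin_two_of]; simp⟩

/-- The matrix of the quarter turn. -/
def matD : SL(2, ℝ) :=
  ⟨!![0, 1; -1, 0], by rw [Matrix.det_fin_two_of]; simp⟩

/-- The class of a matrix of `SL(2,ℝ)` in `PSL(2,ℝ)`. -/
def cls (M : SL(2, ℝ)) : G := QuotientGroup.mk M

def a (t : ℝ) : G := cls (matA t)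
def b (s : ℝ) : G := cls (matB s)
def c (u : ℝ) : G := cls (matC u)
def dPi : G := cls matD

/-! ### The left-invariant Riemannian distance on `PSL(2,ℝ)` -/

/-- The entrywise derivative of a curve of matrices. -/
def velocity (γ : ℝ → SL(2, ℝ)) (t : ℝ) : Matrix (Fin 2) (Fin 2) ℝ :=
  Matrix.of fun i j => deriv (fun r => (γ r : Matrix (Fin 2) (Fin 2) ℝ) i j) t

/-- The speed of a curve in the left-invariant Riemannian metric which on the Lie algebra is
`⟨A, B⟩ = tr (Aᵀ B)`: the Frobenius norm of `γ(t)⁻¹ γ'(t)`. -/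
def speed (γ : ℝ → SL(2, ℝ)) (t : ℝ) : ℝ :=
  Real.sqrt (∑ i, ∑ j,
    ((((γ t)⁻¹ : SL(2, ℝ)) : Matrix (Fin 2) (Fin 2) ℝ) * velocity γ t) i j ^ 2)

/-- A continuously differentiable curve in `SL(2,ℝ)`. -/
def IsC1Curve (γ : ℝ → SL(2, ℝ)) : Prop :=
  ∀ i j, ContDiff ℝ 1 fun r => (γ r : Matrix (Fin 2) (Fin 2) ℝ) i j

/-- The Riemannian distance on `PSL(2,ℝ)`: the infimum of the lengths of the `C¹` curves from
`g` to `h`, each of them written through a lift to `SL(2,ℝ)`. -/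
def dG (g h : G) : ℝ :=
  sInf {r : ℝ | ∃ γ : ℝ → SL(2, ℝ), IsC1Curve γ ∧ cls (γ 0) = g ∧ cls (γ 1) = h ∧
    r = ∫ t in (0 : ℝ)..1, speed γ t}

/-! ### The phase space `X = Γ \ PSL(2,ℝ)` -/

/-- The space of cosets `Γ g`, with the quotient topology. -/
abbrev X (Γ : Subgroup G) : Type := Quotient (QuotientGroup.rightRel Γ)

/-- The coset `Γ g`. -/
def proj (Γ : Subgroup G) (g : G) : X Γ := Quotient.mk (QuotientGroup.rightRel Γ) g

/-- Right multiplication `Γ g ↦ Γ g k`. -/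
def rmul (Γ : Subgroup G) (k : G) : X Γ → X Γ :=
  Quotient.map (fun g => g * k) (by
    intro g h hgh
    have h1 : h * g⁻¹ ∈ Γ := QuotientGroup.rightRel_apply.1 hgh
    refine QuotientGroup.rightRel_apply.2 ?_
    simpa [mul_assoc] using h1)

/-- The flow `φ_t (Γ g) = Γ g a_t`. -/
def flow (Γ : Subgroup G) (t : ℝ) (x : X Γ) : X Γ := rmul Γ (a t) x

/-- Time reversal `Γ g ↦ Γ g d_π`. -/
def rev (Γ : Subgroup G) (x : X Γ) : X Γ := rmul Γ dPi x

/-- The distance on `X`: the infimum of `dG` over all representatives. -/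
def dX (Γ : Subgroup G) (x y : X Γ) : ℝ :=
  sInf {r : ℝ | ∃ g h : G, proj Γ g = x ∧ proj Γ h = y ∧ r = dG g h}

/-- The orbit of `x`. -/
def orbit (Γ : Subgroup G) (x : X Γ) : Set (X Γ) := Set.range fun t : ℝ => flow Γ t x

/-- `O` is a `T`-periodic orbit of the flow (`T > 0` is a period, not necessarily the least). -/
def IsPeriodicOrbit (Γ : Subgroup G) (T : ℝ) (O : Set (X Γ)) : Prop :=
  0 < T ∧ ∃ x : X Γ, flow Γ T x = x ∧ O = orbit Γ x

/-- `z = (u, s)_x ∈ P_ε(x)`: the point `z` lies in the Poincaré section of radius `ε` at `x`,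
with coordinates `(u, s)`. -/
def HasCoords (Γ : Subgroup G) (ε : ℝ) (x z : X Γ) (u s : ℝ) : Prop :=
  |u| < ε ∧ |s| < ε ∧ ∃ g : G, proj Γ g = x ∧ z = proj Γ (g * c u * b s)

/-! ### Partner orbits -/

/-- The `T`-periodic orbit `O` and the `T'`-periodic orbit `O'` are an `ε`-orbit pair (each is an
`ε`-partner orbit of the other). -/
def IsOrbitPair (Γ : Subgroup G) (ε T : ℝ) (O : Set (X Γ)) (T' : ℝ) (O' : Set (X Γ)) : Prop :=
  IsPeriodicOrbit Γ T O ∧ IsPeriodicOrbit Γ T' O' ∧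
  ∃ L : ℕ, 2 ≤ L ∧ ∃ t t' : Fin (L + 1) → ℝ,
    StrictMono t ∧ t 0 = 0 ∧ t (Fin.last L) = T ∧
    StrictMono t' ∧ t' 0 = 0 ∧ t' (Fin.last L) = T' ∧
    ∃ σ : Equiv.Perm (Fin L), ∃ x ∈ O, ∃ x' ∈ O', ∀ j : Fin L,
      (∀ τ ∈ Set.Icc 0 (t j.succ - t j.castSucc),
        dX Γ (flow Γ (τ + t j.castSucc) x) (flow Γ (τ + t' (σ j).castSucc) x') < ε) ∨
      (∀ τ ∈ Set.Icc 0 (t j.succ - t j.castSucc),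
        dX Γ (flow Γ (τ + t j.castSucc) x) (flow Γ (τ - t' (σ j).succ) (rev Γ x')) < ε)

/-- The orbit of `q` stays `ε`-close to the orbit of `p` during the time `l`. -/
def FollowsFor (Γ : Subgroup G) (ε l : ℝ) (p q : X Γ) : Prop :=
  ∀ τ ∈ Set.Icc 0 l, dX Γ (flow Γ τ p) (flow Γ τ q) < ε

/-- Let a periodic orbit run through `x, y, z, w` and back to `x`, needing the times
`T₁, T₂, T₃, T₄`, where `y, z` are the two passages through one antiparallel encounter and
`w, x` the two passages through another one. The `T'`-periodic orbit `O'` is obtained by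
reconnecting the stretches in both encounters: up to errors smaller than `ε` (in distance, and in
the durations of the stretches) it consists of the stretch from `y` to `z`, the stretch from `x`
to `y` traversed backwards, the stretch from `w` to `x`, and the stretch from `z` to `w`
traversed backwards, in this order. -/
def DiffersInBoth (Γ : Subgroup G) (ε : ℝ) (x y z w : X Γ) (T₁ T₂ T₃ T₄ T' : ℝ)
    (O' : Set (X Γ)) : Prop :=
  ∃ v ∈ O', ∃ r₁ r₂ r₃ r₄ : ℝ,
    0 < r₁ ∧ 0 < r₂ ∧ 0 < r₃ ∧ 0 < r₄ ∧ r₂ + r₁ + r₄ + r₃ = T' ∧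
    |r₁ - T₁| < ε ∧ |r₂ - T₂| < ε ∧ |r₃ - T₃| < ε ∧ |r₄ - T₄| < ε ∧
    FollowsFor Γ ε T₂ y v ∧
    FollowsFor Γ ε T₁ x (rev Γ (flow Γ (r₂ + r₁) v)) ∧
    FollowsFor Γ ε T₄ w (flow Γ (r₂ + r₁) v) ∧
    FollowsFor Γ ε T₃ z (rev Γ (flow Γ T' v))

/-! ### The two constants -/

/-- Every nontrivial element of `Γ` moves every element of `PSL(2,ℝ)` by more than `σ₀`. -/
def IsSeparationConst (Γ : Subgroup G) (σ₀ : ℝ) : Prop :=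
  0 < σ₀ ∧ ∀ γ ∈ Γ, γ ≠ 1 → ∀ g : G, σ₀ < dG (γ * g) g

/-- The expansivity property of periodic orbits with constant `e`. -/
def IsExpansivityConst (Γ : Subgroup G) (e : ℝ) : Prop :=
  0 < e ∧ ∀ ε : ℝ, 0 < ε → ε < e → ∀ (x₁ x₂ : X Γ) (T₁ T₂ : ℝ), 0 < T₁ → 0 < T₂ →
    flow Γ T₁ x₁ = x₁ → flow Γ T₂ x₂ = x₂ → |T₁ - T₂| ≤ Real.sqrt 2 * ε →
    (∀ t ∈ Set.Icc 0 (min T₁ T₂), dX Γ (flow Γ t x₁) (flow Γ t x₂) < ε) →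
    T₁ = T₂ ∧ orbit Γ x₁ = orbit Γ x₂

end HadamardGutzwiller

end

/-!
The partner orbit is the projection of the axis of an explicit hyperbolic element of `Γ`.

Let `g` be a lift of `y`. The two encounters and the periodicity of the given orbit provide elements
`A, B, C ∈ Γ` with `g a_{T₂} d_π = A g c_{u₁} b_{s₁}`, `g a_{-T₁} c_{u₂} b_{s₂} =
B g a_{T₂+T₃} d_π` and `g a_T = C g`. Following the reconnected stretches in the
group leads from `g` to the neighbourhood of `η g`, where `η = A B C B A`, and conjugation by `g`
turns `η` into the product
`M = a_{T₂} (c_{s₁} b_{u₁}) a_{T₁} (b_{-u₂} c_{-s₂}) a_{T₄} (c_{u₂} b_{s₂}) a_{T₃}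
(b_{-s₁} c_{-u₁})`
of four flow segments and four jumps close to the identity. The hypotheses force `ε ^ 2 ≤ 1 / 30`
and make `T₁, T₂, T₃` large, so that on slopes of directions `M` and `M⁻¹` act by compositions of
Möbius maps which send a small interval into itself (`exists_mobius_cycle`). Their fixed points are
the expanding and the contracting direction of `M`. The slopes at the intermediate stages of the
cycles say how far the axis of `M` is from the given orbit at the four encounter points
(`exists_closing_frames`), which yields the shadowing estimates, and the stretching factors along
the expanding direction multiply to `e^{T'/2}`, which yields the action difference
(`shift_estimates`).

Expansivity and uniqueness rest on two facts. Lifts of shadowing orbits that are close at one time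
are close at all times, as a nontrivial element of `Γ` moves every point by a definite amount
(`FollowsFor.dG_lt`); hence every orbit that follows the four stretches in the prescribed order has
a lift that is translated along itself by the same `η` (`exists_lift_of_differsInBoth`). And an
element of the group translates at most one flow line along itself in the positive direction, by a
well-defined amount (`eq_of_mul_eq_mul_a`). Neither needs a comparison of the Riemannian distance
with the matrix entries from below; such a comparison (`exists_entry_bound_of_hasPath`) only enters
the proof that a discrete cocompact group has a separation constant (`exists_isSeparationConst`).
-/

noncomputable section

namespace HadamardGutzwiller

/-! ### Curves in `SL(2,ℝ)` and their length -/

lemma coe_matA (t : ℝ) : (matA t : Matrix (Fin 2) (Fin 2) ℝ) =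
    !![Real.exp (t / 2), 0; 0, Real.exp (-(t / 2))] := rfl
lemma coe_matB (s : ℝ) : (matB s : Matrix (Fin 2) (Fin 2) ℝ) = !![1, s; 0, 1] := rfl
lemma coe_matC (u : ℝ) : (matC u : Matrix (Fin 2) (Fin 2) ℝ) = !![1, 0; u, 1] := rfl
lemma coe_matD : (matD : Matrix (Fin 2) (Fin 2) ℝ) = !![0, 1; -1, 0] := rfl

lemma mul_entry (M N : SL(2, ℝ)) (i j : Fin 2) : (M * N).1 i j =
    M.1 i 0 * N.1 0 j + M.1 i 1 * N.1 1 j := by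
  rw [Matrix.SpecialLinearGroup.coe_mul, Matrix.mul_apply, Fin.sum_univ_two]

lemma det_entries (M : SL(2, ℝ)) : M.1 0 0 * M.1 1 1 - M.1 0 1 * M.1 1 0 = 1 := by
  rw [← Matrix.det_fin_two, M.2]

lemma sl_ext {M N : SL(2, ℝ)} (h₁ : M.1 0 0 = N.1 0 0) (h₂ : M.1 0 1 = N.1 0 1)
    (h₃ : M.1 1 0 = N.1 1 0) (h₄ : M.1 1 1 = N.1 1 1) : M = N := by
  ext i j
  fin_cases i <;> fin_cases j <;> assumption

lemma IsC1Curve.hasDerivAt {γ : ℝ → SL(2, ℝ)} (hγ : IsC1Curve γ) (t : ℝ) (i j : Fin 2) :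
    HasDerivAt (fun r => (γ r : Matrix (Fin 2) (Fin 2) ℝ) i j) (velocity γ t i j) t :=
  ((hγ i j).differentiable (by norm_num) t).hasDerivAt

lemma velocity_eq_of_hasDerivAt {γ : ℝ → SL(2, ℝ)} {t : ℝ} {V : Matrix (Fin 2) (Fin 2) ℝ}
    (h : ∀ i j, HasDerivAt (fun r => (γ r : Matrix (Fin 2) (Fin 2) ℝ) i j) (V i j) t) :
    velocity γ t = V := by
  ext i j
  exact (h i j).deriv

lemma continuous_velocity {γ : ℝ → SL(2, ℝ)} (hγ : IsC1Curve γ) (i j : Fin 2) :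
    Continuous fun t => velocity γ t i j :=
  (hγ i j).continuous_deriv le_rfl

lemma speed_nonneg (γ : ℝ → SL(2, ℝ)) (t : ℝ) : 0 ≤ speed γ t := Real.sqrt_nonneg _

lemma continuous_speed {γ : ℝ → SL(2, ℝ)} (hγ : IsC1Curve γ) : Continuous (speed γ) := by
  have h1 := fun i j => (hγ i j).continuous
  have h2 := continuous_velocity hγ
  unfold speed
  simp only [Matrix.SpecialLinearGroup.coe_inv, Matrix.adjugate_fin_two, Matrix.mul_apply,
    Fin.sum_univ_two, Matrix.of_apply, Matrix.cons_val', Matrix.cons_val_zero,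
    Matrix.cons_val_one, Matrix.cons_val_fin_one]
  fun_prop

lemma velocity_congr {γ δ : ℝ → SL(2, ℝ)} {t : ℝ} (h : γ =ᶠ[nhds t] δ) :
    velocity γ t = velocity δ t := by
  ext i j
  exact Filter.EventuallyEq.deriv_eq (h.mono fun r hr => by simp [hr])

lemma speed_congr {γ δ : ℝ → SL(2, ℝ)} {t : ℝ} (h : γ =ᶠ[nhds t] δ) :
    speed γ t = speed δ t := by
  simp only [speed, velocity_congr h, h.eq_of_nhds]

lemma IsC1Curve.mul {γ δ : ℝ → SL(2, ℝ)} (hγ : IsC1Curve γ) (hδ : IsC1Curve δ) :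
    IsC1Curve fun t => γ t * δ t := by
  intro i j
  simp only [Matrix.SpecialLinearGroup.coe_mul, Matrix.mul_apply, Fin.sum_univ_two]
  exact ((hγ _ _).mul (hδ _ _)).add ((hγ _ _).mul (hδ _ _))

lemma isC1Curve_const (K : SL(2, ℝ)) : IsC1Curve fun _ => K := fun _ _ => contDiff_const

lemma IsC1Curve.comp {γ : ℝ → SL(2, ℝ)} (hγ : IsC1Curve γ) {θ : ℝ → ℝ} (hθ : ContDiff ℝ 1 θ) :
    IsC1Curve fun t => γ (θ t) := fun i j => (hγ i j).comp hθ

/-- The length element is invariant under left translations. -/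
lemma speed_const_mul {γ : ℝ → SL(2, ℝ)} (hγ : IsC1Curve γ) (K : SL(2, ℝ)) (t : ℝ) :
    speed (fun r => K * γ r) t = speed γ t := by
  have h : velocity (fun r => K * γ r) t = (K : Matrix (Fin 2) (Fin 2) ℝ) * velocity γ t := by
    refine velocity_eq_of_hasDerivAt fun i j => ?_
    simp only [Matrix.SpecialLinearGroup.coe_mul, Matrix.mul_apply, Fin.sum_univ_two]
    exact ((hγ.hasDerivAt t 0 j).const_mul _).add ((hγ.hasDerivAt t 1 j).const_mul _)
  have hK : ((K⁻¹ : SL(2, ℝ)) : Matrix (Fin 2) (Fin 2) ℝ) * (K : Matrix (Fin 2) (Fin 2) ℝ) = 1 := by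
    rw [← Matrix.SpecialLinearGroup.coe_mul]; simp
  unfold speed
  rw [h, mul_inv_rev, Matrix.SpecialLinearGroup.coe_mul, Matrix.mul_assoc,
    ← Matrix.mul_assoc _ _ (velocity γ t), hK, Matrix.one_mul]

/-- The quarter turn is orthogonal, so right translation by it preserves the length element. -/
lemma speed_mul_matD {γ : ℝ → SL(2, ℝ)} (hγ : IsC1Curve γ) (t : ℝ) :
    speed (fun r => γ r * matD) t = speed γ t := by
  have h : velocity (fun r => γ r * matD) t =
      velocity γ t * (matD : Matrix (Fin 2) (Fin 2) ℝ) := by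
    refine velocity_eq_of_hasDerivAt fun i j => ?_
    simp only [Matrix.SpecialLinearGroup.coe_mul, Matrix.mul_apply, Fin.sum_univ_two]
    exact ((hγ.hasDerivAt t i 0).mul_const _).add ((hγ.hasDerivAt t i 1).mul_const _)
  unfold speed
  rw [h, mul_inv_rev, Matrix.SpecialLinearGroup.coe_mul, Matrix.mul_assoc,
    ← Matrix.mul_assoc _ (velocity γ t)]
  congr 1
  generalize ((γ t)⁻¹ : SL(2, ℝ)).1 * velocity γ t = V
  simp [coe_matD, Matrix.mul_apply, Fin.sum_univ_two, Matrix.SpecialLinearGroup.coe_inv,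
    Matrix.adjugate_fin_two]
  ring

lemma speed_comp {γ : ℝ → SL(2, ℝ)} (hγ : IsC1Curve γ) {θ : ℝ → ℝ} {θ' t : ℝ}
    (hθ : HasDerivAt θ θ' t) :
    speed (fun r => γ (θ r)) t = |θ'| * speed γ (θ t) := by
  have h : velocity (fun r => γ (θ r)) t = θ' • velocity γ (θ t) := by
    refine velocity_eq_of_hasDerivAt fun i j => ?_
    have := (hγ.hasDerivAt (θ t) i j).comp t hθ
    simpa [mul_comm, Function.comp_def] using this
  unfold speed
  rw [h, ← Real.sqrt_sq_eq_abs, ← Real.sqrt_mul (sq_nonneg _)]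
  congr 1
  simp only [Matrix.mul_smul, Matrix.smul_apply, smul_eq_mul, Fin.sum_univ_two]
  ring

/-- There is a `C¹` curve of length `r` from `g` to `h`. -/
def HasPath (g h : G) (r : ℝ) : Prop :=
  ∃ γ : ℝ → SL(2, ℝ), IsC1Curve γ ∧ cls (γ 0) = g ∧ cls (γ 1) = h ∧
    r = ∫ t in (0 : ℝ)..1, speed γ t

lemma HasPath.nonneg {g h : G} {r : ℝ} (H : HasPath g h r) : 0 ≤ r := by
  obtain ⟨γ, -, -, -, rfl⟩ := H
  exact intervalIntegral.integral_nonneg zero_le_one fun t _ => speed_nonneg γ t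

lemma cls_mul (M N : SL(2, ℝ)) : cls (M * N) = cls M * cls N := rfl
lemma cls_one : cls 1 = 1 := rfl
lemma cls_inv (M : SL(2, ℝ)) : cls M⁻¹ = (cls M)⁻¹ := rfl
lemma exists_cls (g : G) : ∃ M, cls M = g := QuotientGroup.mk_surjective g

lemma HasPath.mul_left {g h : G} {r : ℝ} (H : HasPath g h r) (k : G) :
    HasPath (k * g) (k * h) r := by
  obtain ⟨γ, hγ, h0, h1, hr⟩ := H
  obtain ⟨K, rfl⟩ := exists_cls k
  refine ⟨fun t => K * γ t, (isC1Curve_const K).mul hγ, by simp [cls_mul, h0],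
    by simp [cls_mul, h1], ?_⟩
  simp only [speed_const_mul hγ, hr]

lemma HasPath.mul_dPi {g h : G} {r : ℝ} (H : HasPath g h r) :
    HasPath (g * dPi) (h * dPi) r := by
  obtain ⟨γ, hγ, h0, h1, hr⟩ := H
  refine ⟨fun t => γ t * matD, hγ.mul (isC1Curve_const _), by simp [cls_mul, h0, dPi],
    by simp [cls_mul, h1, dPi], ?_⟩
  simp only [speed_mul_matD hγ, hr]

lemma HasPath.symm {g h : G} {r : ℝ} (H : HasPath g h r) : HasPath h g r := by
  obtain ⟨γ, hγ, h0, h1, hr⟩ := H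
  refine ⟨fun t => γ (1 - t), hγ.comp (by fun_prop), by simpa using h1, by simpa using h0, ?_⟩
  have h : ∀ t, speed (fun t => γ (1 - t)) t = speed γ (1 - t) := fun t => by
    have := speed_comp hγ ((hasDerivAt_id t).const_sub 1)
    simpa using this
  simp only [h, hr]
  rw [intervalIntegral.integral_comp_sub_left (fun t => speed γ t)]
  simp

/-- A `C¹` curve reparametrized by a monotone function keeps its length. -/
lemma integral_speed_comp {γ : ℝ → SL(2, ℝ)} (hγ : IsC1Curve γ) {θ : ℝ → ℝ}
    (hθ : ContDiff ℝ 1 θ) (hm : Monotone θ) (p q : ℝ) :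
    ∫ t in p..q, speed (fun r => γ (θ r)) t = ∫ t in θ p..θ q, speed γ t := by
  have hd : ∀ t, HasDerivAt θ (deriv θ t) t := fun t =>
    (hθ.differentiable (by norm_num) t).hasDerivAt
  rw [← intervalIntegral.integral_comp_mul_deriv (fun t _ => hd t)
    (hθ.continuous_deriv le_rfl).continuousOn (continuous_speed hγ)]
  refine intervalIntegral.integral_congr fun t _ => ?_
  simp only [speed_comp hγ (hd t), abs_of_nonneg hm.deriv_nonneg, Function.comp, mul_comm]

/-- Concatenation of curves. The two pieces are run with reparametrizations that are constant
outside of complementary halves of the unit interval; the concatenated curve is the product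
`γ₁ · γ₂(0)⁻¹ · γ₂`, which needs no matching of the lifts to `SL(2,ℝ)`. -/
lemma HasPath.trans {g h k : G} {r r' : ℝ} (H : HasPath g h r) (H' : HasPath h k r') :
    HasPath g k (r + r') := by
  obtain ⟨γ, hγ, h0, h1, hr⟩ := H
  obtain ⟨δ, hδ, k0, k1, hr'⟩ := H'
  set θ : ℝ → ℝ := fun t => Real.smoothTransition (2 * t)
  set η : ℝ → ℝ := fun t => Real.smoothTransition (2 * t - 1)
  have hθ : ContDiff ℝ 1 θ := Real.smoothTransition.contDiff.comp (by fun_prop)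
  have hη : ContDiff ℝ 1 η := Real.smoothTransition.contDiff.comp (by fun_prop)
  have mθ : Monotone θ := fun s t hst => Real.smoothTransition.monotone (by linarith)
  have mη : Monotone η := fun s t hst => Real.smoothTransition.monotone (by linarith)
  have θ1 : ∀ t, 1 / 2 ≤ t → θ t = 1 := fun t ht =>
    Real.smoothTransition.one_of_one_le (by linarith)
  have η0 : ∀ t, t ≤ 1 / 2 → η t = 0 := fun t ht =>
    Real.smoothTransition.zero_of_nonpos (by linarith)
  have θ0 : θ 0 = 0 := by simp [θ]
  have η1 : η 1 = 1 := by simp only [η]; norm_num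
  set ξ : ℝ → SL(2, ℝ) := fun t => γ (θ t) * ((δ 0)⁻¹ * δ (η t))
  have hξ : IsC1Curve ξ := (hγ.comp hθ).mul ((isC1Curve_const _).mul (hδ.comp hη))
  refine ⟨ξ, hξ, ?_, ?_, ?_⟩
  · simp [ξ, θ0, η0 0 (by norm_num), h0]
  · simp [ξ, θ1 1 (by norm_num), η1, cls_mul, cls_inv, h1, k0, k1]
  · have hint := fun p q => (continuous_speed hξ).intervalIntegrable (μ := MeasureTheory.volume) p q
    rw [← intervalIntegral.integral_add_adjacent_intervals (hint 0 (1 / 2)) (hint (1 / 2) 1)]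
    congr 1
    · have e : Set.EqOn (speed ξ) (speed fun t => γ (θ t)) (Set.Ioo 0 (1 / 2)) := by
        intro t ht
        refine speed_congr ?_
        filter_upwards [Iio_mem_nhds ht.2] with s hs
        simp [ξ, η0 s (le_of_lt hs)]
      rw [hr, intervalIntegral.integral_congr_Ioo_of_le (by norm_num) e,
        integral_speed_comp hγ hθ mθ, θ0, θ1 _ le_rfl]
    · have e : Set.EqOn (speed ξ) (speed fun t => δ (η t)) (Set.Ioo (1 / 2) 1) := by
        intro t ht
        have h2 : ξ =ᶠ[nhds t] fun s => (γ 1 * (δ 0)⁻¹) * δ (η s) := by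
          filter_upwards [Ioi_mem_nhds ht.1] with s hs
          simp [ξ, θ1 s (le_of_lt hs), mul_assoc]
        rw [speed_congr h2, speed_const_mul (hδ.comp hη)]
      rw [hr', intervalIntegral.integral_congr_Ioo_of_le (by norm_num) e,
        integral_speed_comp hδ hη mη, η1, η0 _ le_rfl]

/-! ### One-parameter subgroups -/

lemma hasPath_b (s : ℝ) : HasPath 1 (b s) |s| := by
  refine ⟨fun t => matB (t * s), ?_, ?_, by simp [b], ?_⟩
  · intro i j
    fin_cases i <;> fin_cases j <;> simp [matB] <;> fun_prop
  · rw [← cls_one]; congr 1; ext i j; fin_cases i <;> fin_cases j <;> simp [matB]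
  · have h : ∀ t, speed (fun t => matB (t * s)) t = |s| := fun t => by
      have hv : velocity (fun t => matB (t * s)) t = !![0, s; 0, 0] := by
        refine velocity_eq_of_hasDerivAt fun i j => ?_
        fin_cases i <;> fin_cases j <;> simp [matB, hasDerivAt_const]
        simpa using (hasDerivAt_id t).mul_const s
      rw [speed, hv, ← Real.sqrt_sq_eq_abs]
      simp [coe_matB, Matrix.SpecialLinearGroup.coe_inv, Matrix.adjugate_fin_two, Matrix.mul_apply,
        Fin.sum_univ_two]
    simp [h]

lemma hasPath_c (u : ℝ) : HasPath 1 (c u) |u| := by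
  refine ⟨fun t => matC (t * u), ?_, ?_, by simp [c], ?_⟩
  · intro i j
    fin_cases i <;> fin_cases j <;> simp [matC] <;> fun_prop
  · rw [← cls_one]; congr 1; ext i j; fin_cases i <;> fin_cases j <;> simp [matC]
  · have h : ∀ t, speed (fun t => matC (t * u)) t = |u| := fun t => by
      have hv : velocity (fun t => matC (t * u)) t = !![0, 0; u, 0] := by
        refine velocity_eq_of_hasDerivAt fun i j => ?_
        fin_cases i <;> fin_cases j <;> simp [matC, hasDerivAt_const]
        simpa using (hasDerivAt_id t).mul_const u
      rw [speed, hv, ← Real.sqrt_sq_eq_abs]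
      simp [coe_matC, Matrix.SpecialLinearGroup.coe_inv, Matrix.adjugate_fin_two, Matrix.mul_apply,
        Fin.sum_univ_two]
    simp [h]

lemma hasPath_a (τ : ℝ) : ∃ r ≤ |τ|, HasPath 1 (a τ) r := by
  refine ⟨_, ?_, fun t => matA (t * τ), ?_, ?_, by simp [a], rfl⟩
  swap
  · intro i j
    fin_cases i <;> fin_cases j <;> simp [matA] <;> fun_prop
  swap
  · rw [← cls_one]; congr 1; ext i j; fin_cases i <;> fin_cases j <;> simp [matA]
  · have h : ∀ t, speed (fun t => matA (t * τ)) t ≤ |τ| := fun t => by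
      have hv : velocity (fun t => matA (t * τ)) t =
          !![Real.exp (t * τ / 2) * (τ / 2), 0; 0, Real.exp (-(t * τ / 2)) * (-(τ / 2))] := by
        refine velocity_eq_of_hasDerivAt fun i j => ?_
        have h1 : HasDerivAt (fun t => t * τ / 2) (τ / 2) t := by
          simpa using ((hasDerivAt_id t).mul_const τ).div_const 2
        fin_cases i <;> fin_cases j <;> simp [matA, hasDerivAt_const]
        · exact h1.exp
        · simpa using h1.neg.exp
      rw [speed, hv, ← Real.sqrt_sq_eq_abs]
      refine Real.sqrt_le_sqrt ?_
      have e : Real.exp (-(t * τ / 2)) * Real.exp (t * τ / 2) = 1 := by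
        rw [← Real.exp_add]; simp
      have e1 : Real.exp (-(t * τ / 2)) * (Real.exp (t * τ / 2) * (τ / 2)) = τ / 2 := by
        rw [← mul_assoc, e, one_mul]
      have e2 : Real.exp (t * τ / 2) * (Real.exp (-(t * τ / 2)) * (τ / 2)) = τ / 2 := by
        rw [← mul_assoc, mul_comm (Real.exp (t * τ / 2)), e, one_mul]
      simp [coe_matA, Matrix.SpecialLinearGroup.coe_inv, Matrix.adjugate_fin_two, Matrix.mul_apply,
        Fin.sum_univ_two, e1, e2]
      nlinarith [sq_nonneg τ]
    have := intervalIntegral.norm_integral_le_of_norm_le_const (a := 0) (b := 1)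
      (f := speed fun t => matA (t * τ)) (C := |τ|) (fun t _ => by
        rw [Real.norm_of_nonneg (speed_nonneg _ _)]; exact h t)
    simpa using (le_abs_self _).trans this

lemma cls_eq_cls_iff {M N : SL(2, ℝ)} : cls M = cls N ↔ M = N ∨ M = -N := by
  rw [cls, cls, QuotientGroup.eq, Matrix.SpecialLinearGroup.mem_center_iff]
  constructor
  · rintro ⟨r, hr, hrM⟩
    have h2 : ∀ i j, N.1 i j = r * M.1 i j := fun i j => by
      have h3 : N = M * (M⁻¹ * N) := by group
      rw [h3, mul_entry, ← hrM]
      fin_cases j <;> simp [mul_comm]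
    rw [Fintype.card_fin] at hr
    rw [sq] at hr
    rcases mul_self_eq_one_iff.1 hr with rfl | rfl
    · left; ext i j; simp [h2]
    · right; ext i j; simp [h2]
  · rintro (rfl | rfl)
    · exact ⟨1, by simp, by simp⟩
    · refine ⟨-1, by simp, ?_⟩
      rw [inv_neg, neg_mul, inv_mul_cancel]
      ext i j
      fin_cases i <;> fin_cases j <;> simp

lemma cls_neg (M : SL(2, ℝ)) : cls (-M) = cls M := cls_eq_cls_iff.2 (Or.inr rfl)

/-- Every matrix with positive upper left entry is a product `c_u a_t b_s`. -/
lemma eq_c_mul_a_mul_b {M : SL(2, ℝ)} (h : 0 < M.1 0 0) :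
    M = matC (M.1 1 0 / M.1 0 0) * matA (2 * Real.log (M.1 0 0)) * matB (M.1 0 1 / M.1 0 0) := by
  have hd := det_entries M
  have e1 : Real.exp (2 * Real.log (M.1 0 0) / 2) = M.1 0 0 := by
    rw [mul_div_cancel_left₀ _ two_ne_zero, Real.exp_log h]
  have e2 : Real.exp (-(2 * Real.log (M.1 0 0) / 2)) = (M.1 0 0)⁻¹ := by
    rw [Real.exp_neg, e1]
  have h0 := h.ne'
  refine sl_ext ?_ ?_ ?_ ?_ <;>
    simp only [mul_entry, coe_matA, coe_matB, coe_matC, e1, e2, Matrix.of_apply, Matrix.cons_val',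
      Matrix.cons_val_zero, Matrix.cons_val_one, Matrix.cons_val_fin_one] <;> field_simp
  · ring
  · ring
  · ring
  · linarith

lemma exists_hasPath (g h : G) : ∃ r, HasPath g h r := by
  have trans1 : ∀ k l : G, (∃ r, HasPath 1 k r) → (∃ r, HasPath 1 l r) →
      ∃ r, HasPath 1 (k * l) r := by
    rintro k l ⟨r, hr⟩ ⟨r', hr'⟩
    have := hr'.mul_left k
    rw [mul_one] at this
    exact ⟨_, hr.trans this⟩
  have hpos : ∀ M : SL(2, ℝ), 0 < M.1 0 0 → ∃ r, HasPath 1 (cls M) r := by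
    intro M hM
    rw [eq_c_mul_a_mul_b hM, cls_mul, cls_mul]
    obtain ⟨r, -, hr⟩ := hasPath_a (2 * Real.log (M.1 0 0))
    exact trans1 _ _ (trans1 _ _ ⟨_, hasPath_c _⟩ ⟨r, hr⟩) ⟨_, hasPath_b _⟩
  have hne : ∀ M : SL(2, ℝ), M.1 0 0 ≠ 0 → ∃ r, HasPath 1 (cls M) r := by
    intro M hM
    rcases lt_or_gt_of_ne hM with h | h
    · rw [← cls_neg]
      exact hpos _ (by simpa using h)
    · exact hpos M h
  have hall : ∀ k : G, ∃ r, HasPath 1 k r := by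
    intro k
    obtain ⟨M, rfl⟩ := exists_cls k
    by_cases hM : M.1 0 0 = 0
    · have hd := M.2
      rw [Matrix.det_fin_two, hM] at hd
      have h1 : M.1 1 0 ≠ 0 := fun h => by simp [h] at hd
      have h2 : M = matB (-1) * (matB 1 * M) := by
        rw [← mul_assoc, show matB (-1) * matB 1 = 1 by
          refine sl_ext ?_ ?_ ?_ ?_ <;> simp [mul_entry, coe_matB], one_mul]
      rw [h2, cls_mul]
      refine trans1 _ _ ⟨_, hasPath_b _⟩ (hne _ ?_)
      simpa [mul_entry, coe_matB, hM] using h1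
    · exact hne M hM
  obtain ⟨r, hr⟩ := hall (g⁻¹ * h)
  have := hr.mul_left g
  rw [mul_one, mul_inv_cancel_left] at this
  exact ⟨r, this⟩

/-! ### The distance on the group -/

lemma dG_le_of_hasPath {g h : G} {r : ℝ} (H : HasPath g h r) : dG g h ≤ r :=
  csInf_le ⟨0, fun _ hr => HasPath.nonneg hr⟩ H

lemma exists_hasPath_lt {g h : G} {r : ℝ} (H : dG g h < r) : ∃ l < r, HasPath g h l := by
  obtain ⟨l, hl, hlr⟩ := exists_lt_of_csInf_lt (exists_hasPath g h) H
  exact ⟨l, hlr, hl⟩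

lemma dG_nonneg (g h : G) : 0 ≤ dG g h := Real.sInf_nonneg fun _ hr => HasPath.nonneg hr

lemma dG_triangle (g h k : G) : dG g k ≤ dG g h + dG h k := by
  refine le_of_forall_pos_lt_add fun ε hε => ?_
  obtain ⟨r, hr, Hr⟩ := exists_hasPath_lt (show dG g h < dG g h + ε / 2 by linarith)
  obtain ⟨l, hl, Hl⟩ := exists_hasPath_lt (show dG h k < dG h k + ε / 2 by linarith)
  linarith [dG_le_of_hasPath (Hr.trans Hl)]

lemma dG_comm (g h : G) : dG g h = dG h g := by
  have : ∀ g h, dG g h ≤ dG h g := fun g h => by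
    refine le_of_forall_pos_lt_add fun ε hε => ?_
    obtain ⟨r, hr, Hr⟩ := exists_hasPath_lt (show dG h g < dG h g + ε by linarith)
    linarith [dG_le_of_hasPath Hr.symm]
  exact le_antisymm (this g h) (this h g)

lemma dG_mul_left (k g h : G) : dG (k * g) (k * h) = dG g h := by
  have : ∀ k g h, dG (k * g) (k * h) ≤ dG g h := fun k g h => by
    refine le_of_forall_pos_lt_add fun ε hε => ?_
    obtain ⟨r, hr, Hr⟩ := exists_hasPath_lt (show dG g h < dG g h + ε by linarith)
    linarith [dG_le_of_hasPath (Hr.mul_left k)]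
  refine le_antisymm (this k g h) ?_
  simpa using this k⁻¹ (k * g) (k * h)

lemma dPi_mul_dPi : dPi * dPi = 1 := by
  rw [dPi, ← cls_mul, ← cls_one, ← cls_neg]
  congr 1
  refine sl_ext ?_ ?_ ?_ ?_ <;> simp [coe_matD]

lemma dG_mul_dPi (g h : G) : dG (g * dPi) (h * dPi) = dG g h := by
  have : ∀ g h, dG (g * dPi) (h * dPi) ≤ dG g h := fun g h => by
    refine le_of_forall_pos_lt_add fun ε hε => ?_
    obtain ⟨r, hr, Hr⟩ := exists_hasPath_lt (show dG g h < dG g h + ε by linarith)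
    linarith [dG_le_of_hasPath Hr.mul_dPi]
  refine le_antisymm (this g h) ?_
  simpa [mul_assoc, dPi_mul_dPi] using this (g * dPi) (h * dPi)

lemma dG_mul_self_left (g k : G) : dG g (g * k) = dG 1 k := by
  simpa using dG_mul_left g 1 k

/-- `dG 1 (k * l) ≤ dG 1 k + dG 1 l`: the distance to the identity is a length function. -/
lemma dG_one_mul_le (k l : G) : dG 1 (k * l) ≤ dG 1 k + dG 1 l := by
  simpa [dG_mul_self_left] using dG_triangle 1 k (k * l)

lemma dG_one_a_le (t : ℝ) : dG 1 (a t) ≤ |t| := by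
  obtain ⟨r, hr, H⟩ := hasPath_a t
  exact (dG_le_of_hasPath H).trans hr

lemma dG_one_b_le (s : ℝ) : dG 1 (b s) ≤ |s| := dG_le_of_hasPath (hasPath_b s)
lemma dG_one_c_le (u : ℝ) : dG 1 (c u) ≤ |u| := dG_le_of_hasPath (hasPath_c u)

/-! ### The flow, time reversal and the distance on the quotient -/

lemma a_zero : a 0 = 1 := by
  rw [a, ← cls_one]
  congr 1
  refine sl_ext ?_ ?_ ?_ ?_ <;> simp [coe_matA]

lemma matA_add (s t : ℝ) : matA (s + t) = matA s * matA t := by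
  refine sl_ext ?_ ?_ ?_ ?_ <;> simp [mul_entry, coe_matA, ← Real.exp_add] <;> ring_nf

lemma a_add (s t : ℝ) : a (s + t) = a s * a t := by rw [a, matA_add]; rfl

lemma dPi_mul_a (t : ℝ) : dPi * a t = a (-t) * dPi := by
  rw [dPi, a, a, ← cls_mul, ← cls_mul]
  congr 1
  refine sl_ext ?_ ?_ ?_ ?_ <;> simp [mul_entry, coe_matA, coe_matD, neg_div]

lemma proj_eq_proj_iff {Γ : Subgroup G} {g h : G} :
    proj Γ g = proj Γ h ↔ ∃ γ ∈ Γ, h = γ * g := by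
  refine (Quotient.eq (r := QuotientGroup.rightRel Γ)).trans ?_
  rw [QuotientGroup.rightRel_apply]
  constructor
  · intro hm
    exact ⟨_, hm, by group⟩
  · rintro ⟨γ, hγ, rfl⟩
    simpa using hγ

lemma proj_mul_left {Γ : Subgroup G} {γ : G} (hγ : γ ∈ Γ) (g : G) :
    proj Γ (γ * g) = proj Γ g := (proj_eq_proj_iff.2 ⟨γ, hγ, rfl⟩).symm

lemma exists_proj {Γ : Subgroup G} (x : X Γ) : ∃ g, proj Γ g = x := Quotient.exists_rep x

lemma flow_proj (Γ : Subgroup G) (t : ℝ) (g : G) : flow Γ t (proj Γ g) = proj Γ (g * a t) := rfl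
lemma rev_proj (Γ : Subgroup G) (g : G) : rev Γ (proj Γ g) = proj Γ (g * dPi) := rfl

lemma flow_flow (Γ : Subgroup G) (s t : ℝ) (x : X Γ) :
    flow Γ s (flow Γ t x) = flow Γ (t + s) x := by
  obtain ⟨g, rfl⟩ := exists_proj x
  simp only [flow_proj, a_add, mul_assoc]

lemma flow_zero (Γ : Subgroup G) (x : X Γ) : flow Γ 0 x = x := by
  obtain ⟨g, rfl⟩ := exists_proj x
  simp only [flow_proj, a_zero, mul_one]

lemma flow_rev (Γ : Subgroup G) (t : ℝ) (x : X Γ) :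
    flow Γ t (rev Γ x) = rev Γ (flow Γ (-t) x) := by
  obtain ⟨g, rfl⟩ := exists_proj x
  simp only [flow_proj, rev_proj, mul_assoc, dPi_mul_a]

lemma dX_proj_le (Γ : Subgroup G) (g h : G) : dX Γ (proj Γ g) (proj Γ h) ≤ dG g h :=
  csInf_le ⟨0, by rintro _ ⟨g, h, -, -, rfl⟩; exact dG_nonneg g h⟩ ⟨g, h, rfl, rfl, rfl⟩

lemma exists_dG_lt_of_dX_lt {Γ : Subgroup G} {g h : G} {r : ℝ}
    (H : dX Γ (proj Γ g) (proj Γ h) < r) : ∃ γ ∈ Γ, dG g (γ * h) < r := by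
  obtain ⟨_, ⟨g', h', hg, hh, rfl⟩, hlt⟩ :=
    exists_lt_of_csInf_lt (by exact ⟨_, g, h, rfl, rfl, rfl⟩) H
  obtain ⟨γ, hγ, rfl⟩ := proj_eq_proj_iff.1 hg
  obtain ⟨δ, hδ, rfl⟩ := proj_eq_proj_iff.1 hh
  refine ⟨γ * δ⁻¹, Γ.mul_mem hγ (Γ.inv_mem hδ), ?_⟩
  rw [← dG_mul_left γ] at hlt
  simpa [mul_assoc] using hlt

lemma flow_eq_self_of_mem_orbit {Γ : Subgroup G} {T : ℝ} {x v : X Γ} (hx : flow Γ T x = x)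
    (hv : v ∈ orbit Γ x) : flow Γ T v = v := by
  obtain ⟨t, rfl⟩ := hv
  change flow Γ T (flow Γ t x) = flow Γ t x
  rw [flow_flow, add_comm, ← flow_flow, hx]

lemma orbit_eq_of_mem {Γ : Subgroup G} {x v : X Γ} (hv : v ∈ orbit Γ x) :
    orbit Γ v = orbit Γ x := by
  obtain ⟨t, rfl⟩ := hv
  ext p
  constructor
  · rintro ⟨s, rfl⟩
    exact ⟨t + s, (flow_flow Γ s t x).symm⟩
  · rintro ⟨s, rfl⟩
    refine ⟨s - t, ?_⟩
    change flow Γ (s - t) (flow Γ t x) = flow Γ s x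
    rw [flow_flow, add_sub_cancel]

/-! ### The separation constant of a discrete cocompact group -/

lemma inner_sq_le (p q r s α β γ δ : ℝ) : (p * α + q * β + r * γ + s * δ) ^ 2 ≤
    (α ^ 2 + β ^ 2 + γ ^ 2 + δ ^ 2) * (p ^ 2 + q ^ 2 + (r ^ 2 + s ^ 2)) := by
  linarith [sq_nonneg (p * β - q * α), sq_nonneg (p * γ - r * α), sq_nonneg (p * δ - s * α),
    sq_nonneg (q * γ - r * β), sq_nonneg (q * δ - s * β), sq_nonneg (r * δ - s * γ)]

lemma inner_sq_le_two (x y z w : ℝ) :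
    (x * z + y * w) ^ 2 ≤ (x ^ 2 + y ^ 2) * (z ^ 2 + w ^ 2) := by
  linarith [sq_nonneg (x * w - y * z)]

/-- The Cauchy–Schwarz estimate behind `exists_entry_bound_of_hasPath`: for `R = 1 + (x y; z w)`
and `A = (p q; r s)`, it bounds the inner product of `R - 1` and `R A`. -/
lemma inner_sub_one_mul_sq_le (x y z w p q r s : ℝ) :
    (x * ((1 + x) * p + y * r) + y * ((1 + x) * q + y * s) + z * (z * p + (1 + w) * r)
      + w * (z * q + (1 + w) * s)) ^ 2 ≤
    ((3 / 2) * (x ^ 2 + y ^ 2 + z ^ 2 + w ^ 2 + 1)) ^ 2 * (p ^ 2 + q ^ 2 + (r ^ 2 + s ^ 2)) := by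
  have hα := inner_sq_le_two x z (1 + x) z
  have hβ := inner_sq_le_two y w (1 + x) z
  have hγ := inner_sq_le_two x z y (1 + w)
  have hδ := inner_sq_le_two y w y (1 + w)
  have h1 := inner_sq_le p q r s (x * (1 + x) + z * z) (y * (1 + x) + w * z)
    (x * y + z * (1 + w)) (y * y + w * (1 + w))
  have h3 : (1 + x) ^ 2 + z ^ 2 + (y ^ 2 + (1 + w) ^ 2) ≤
      2 * (x ^ 2 + y ^ 2 + z ^ 2 + w ^ 2) + 4 := by
    linarith [sq_nonneg (x - 1), sq_nonneg (w - 1), sq_nonneg y, sq_nonneg z]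
  have hn : 0 ≤ x ^ 2 + y ^ 2 + z ^ 2 + w ^ 2 := by positivity
  have h4 := mul_le_mul_of_nonneg_left h3 hn
  refine le_trans (le_of_eq (by ring)) (h1.trans (mul_le_mul_of_nonneg_right ?_ (by positivity)))
  linarith [mul_nonneg hn hn]

/-- An element joined to the identity by a short curve has a lift close to the identity matrix:
along the curve, the logarithm of `‖R - 1‖² + 1` grows at most with three times the speed. -/
lemma exists_entry_bound_of_hasPath {k : G} {l : ℝ} (H : HasPath 1 k l) :
    ∃ R : SL(2, ℝ), cls R = k ∧
      (R.1 0 0 - 1) ^ 2 + R.1 0 1 ^ 2 + R.1 1 0 ^ 2 + (R.1 1 1 - 1) ^ 2 ≤ Real.exp (3 * l) - 1 := by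
  obtain ⟨γ, hγ, h0, h1, rfl⟩ := H
  set R : ℝ → SL(2, ℝ) := fun t => (γ 0)⁻¹ * γ t with hR
  have hRC : IsC1Curve R := (isC1Curve_const _).mul hγ
  have hsp : ∀ t, speed R t = speed γ t := speed_const_mul hγ _
  have hR0 : R 0 = 1 := by simp [hR]
  refine ⟨R 1, by simp [hR, cls_mul, cls_inv, h0, h1], ?_⟩
  set f : ℝ → ℝ := fun t => ((R t).1 0 0 - 1) ^ 2 + (R t).1 0 1 ^ 2 + (R t).1 1 0 ^ 2 +
    ((R t).1 1 1 - 1) ^ 2 + 1 with hf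
  have hfpos : ∀ t, 0 < f t := fun t => by simp only [hf]; positivity
  have hd := hRC.hasDerivAt
  set f' : ℝ → ℝ := fun t => 2 * (((R t).1 0 0 - 1) * velocity R t 0 0 +
    (R t).1 0 1 * velocity R t 0 1 + (R t).1 1 0 * velocity R t 1 0 +
    ((R t).1 1 1 - 1) * velocity R t 1 1) with hf'
  have hfd : ∀ t, HasDerivAt f (f' t) t := fun t => by
    have := (((((hd t 0 0).sub_const 1).pow 2).add ((hd t 0 1).pow 2)).add
      ((hd t 1 0).pow 2)).add (((hd t 1 1).sub_const 1).pow 2) |>.add_const 1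
    refine this.congr_deriv ?_
    simp [hf']
    ring
  have hbound : ∀ t, f' t / f t ≤ 3 * speed R t := fun t => by
    rw [div_le_iff₀ (hfpos t)]
    set A := ((R t)⁻¹ : SL(2, ℝ)).1 * velocity R t with hA
    have hV : velocity R t = (R t).1 * A := by
      rw [hA, ← Matrix.mul_assoc, ← Matrix.SpecialLinearGroup.coe_mul]
      simp
    have key := inner_sub_one_mul_sq_le ((R t).1 0 0 - 1) ((R t).1 0 1) ((R t).1 1 0)
      ((R t).1 1 1 - 1) (A 0 0) (A 0 1) (A 1 0) (A 1 1)
    have hs : speed R t = Real.sqrt (A 0 0 ^ 2 + A 0 1 ^ 2 + (A 1 0 ^ 2 + A 1 1 ^ 2)) := by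
      rw [speed, ← hA]
      simp only [Fin.sum_univ_two]
    have hs2 : speed R t ^ 2 = A 0 0 ^ 2 + A 0 1 ^ 2 + (A 1 0 ^ 2 + A 1 1 ^ 2) := by
      rw [hs, Real.sq_sqrt (by positivity)]
    have e : ∀ i j, velocity R t i j = (R t).1 i 0 * A 0 j + (R t).1 i 1 * A 1 j := fun i j => by
      rw [hV, Matrix.mul_apply, Fin.sum_univ_two]
    rw [← hs2, ← mul_pow] at key
    have := (abs_le.1 (abs_le_of_sq_le_sq key
      (mul_nonneg (by positivity) (speed_nonneg R t)))).2
    simp only [hf', hf, e]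
    ring_nf at this ⊢
    linarith
  have hint := intervalIntegral.sub_le_integral_of_hasDeriv_right_of_le (zero_le_one' ℝ)
    (g := fun t => Real.log (f t)) (g' := fun t => f' t / f t) (φ := fun t => 3 * speed R t)
    (fun t _ => ((hfd t).log (hfpos t).ne').continuousAt.continuousWithinAt)
    (fun t _ => ((hfd t).log (hfpos t).ne').hasDerivWithinAt)
    ((continuous_const.mul (continuous_speed hRC)).continuousOn.integrableOn_Icc)
    (fun t _ => hbound t)
  have hf0 : f 0 = 1 := by simp [hf, hR0]
  rw [hf0, Real.log_one, sub_zero, intervalIntegral.integral_const_mul] at hint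
  simp only [hsp] at hint
  have := (Real.log_le_iff_le_exp (hfpos 1)).1 hint
  simp only [hf] at this
  linarith

lemma continuous_entry (i j : Fin 2) : Continuous fun M : SL(2, ℝ) => M.1 i j :=
  (continuous_apply j).comp ((continuous_apply i).comp continuous_subtype_val)

lemma isOpenMap_proj (Γ : Subgroup G) : IsOpenMap (proj Γ) := by
  intro U hU
  change IsOpen ((proj Γ) ⁻¹' (proj Γ '' U))
  have : (proj Γ) ⁻¹' (proj Γ '' U) = ⋃ γ : Γ, (fun g => (γ : G) * g) '' U := by
    ext g
    simp only [Set.mem_preimage, Set.mem_image, Set.mem_iUnion, proj_eq_proj_iff]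
    constructor
    · rintro ⟨h, hh, γ, hγ, rfl⟩
      exact ⟨⟨γ, hγ⟩, h, hh, rfl⟩
    · rintro ⟨γ, h, hh, rfl⟩
      exact ⟨h, hh, γ, γ.2, rfl⟩
  rw [this]
  exact isOpen_iUnion fun γ => (Homeomorph.mulLeft (γ : G)).isOpenMap U hU

/-- In a cocompact group every coset has a representative in a fixed bounded set of matrices. -/
lemma exists_bounded_representatives (Γ : Subgroup G) (hcomp : CompactSpace (X Γ)) :
    ∃ n : ℝ, 0 < n ∧ ∀ g : G, ∃ γ ∈ Γ, ∃ K : SL(2, ℝ), (∀ i j, |K.1 i j| ≤ n) ∧ g = γ * cls K := by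
  set U : ℕ → Set (X Γ) := fun n => proj Γ '' (cls '' {M | ∀ i j, |M.1 i j| < n}) with hU
  have hopen : ∀ n, IsOpen (U n) := fun n => by
    refine isOpenMap_proj Γ _ (QuotientGroup.isOpenMap_coe _ ?_)
    simp only [Set.ofPred_forall]
    exact isOpen_iInter_of_finite fun i => isOpen_iInter_of_finite fun j =>
      isOpen_lt (continuous_entry i j).abs continuous_const
  have hcov : Set.univ ⊆ ⋃ n, U n := by
    intro x _
    obtain ⟨g, rfl⟩ := exists_proj x
    obtain ⟨M, rfl⟩ := exists_cls g
    obtain ⟨n, hn⟩ := exists_nat_gt (∑ i, ∑ j, |M.1 i j|)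
    refine Set.mem_iUnion.2 ⟨n, _, ⟨M, fun i j => lt_of_le_of_lt ?_ hn, rfl⟩, rfl⟩
    exact (Finset.single_le_sum (f := fun j => |M.1 i j|) (fun _ _ => abs_nonneg _)
      (Finset.mem_univ j)).trans (Finset.single_le_sum (f := fun i => ∑ j, |M.1 i j|)
        (fun _ _ => Finset.sum_nonneg fun _ _ => abs_nonneg _) (Finset.mem_univ i))
  have hmono : Monotone U := fun m n hmn => by
    refine Set.image_mono (Set.image_mono fun M hM i j => (hM i j).trans_le ?_)
    exact_mod_cast hmn
  obtain ⟨n, hn⟩ := isCompact_univ.elim_directed_cover U hopen hcov hmono.directed_le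
  refine ⟨n + 1, by positivity, fun g => ?_⟩
  obtain ⟨_, ⟨K, hK, rfl⟩, hg⟩ := hn (Set.mem_univ (proj Γ g))
  obtain ⟨γ, hγ, rfl⟩ := proj_eq_proj_iff.1 hg
  exact ⟨γ, hγ, K, fun i j => (hK i j).le.trans (by linarith), rfl⟩

/-- A discrete subgroup contains no nontrivial class of a matrix close to the identity. -/
lemma exists_entry_gap (Γ : Subgroup G) (hdisc : DiscreteTopology Γ) :
    ∃ η : ℝ, 0 < η ∧ ∀ M : SL(2, ℝ), (∀ i j, |M.1 i j - (1 : SL(2, ℝ)).1 i j| < η) →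
      cls M ∈ Γ → cls M = 1 := by
  obtain ⟨U, hU, hU1⟩ := isOpen_induced_iff.1 (isOpen_discrete ({1} : Set Γ))
  have h1 : (1 : G) ∈ U := by
    have : (1 : Γ) ∈ Subtype.val ⁻¹' U := hU1 ▸ rfl
    exact this
  have hV : IsOpen (cls ⁻¹' U) := hU.preimage continuous_quotient_mk'
  obtain ⟨W, hW, hWV⟩ := isOpen_induced_iff.1 hV
  obtain ⟨η, hη, hball⟩ := (Metric.isOpen_iff (α := Fin 2 → Fin 2 → ℝ) (s := W)).1 hW
    (1 : SL(2, ℝ)).1 (by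
      have : (1 : SL(2, ℝ)) ∈ cls ⁻¹' U := h1
      rw [← hWV] at this
      exact this)
  refine ⟨η, hη, fun M hM hΓ => ?_⟩
  have hMW : M.1 ∈ W := hball <| (dist_pi_lt_iff hη).2 fun i => (dist_pi_lt_iff hη).2 fun j =>
    hM i j
  have hMU : cls M ∈ U := by
    have : M ∈ cls ⁻¹' U := by rw [← hWV]; exact hMW
    exact this
  have : (⟨cls M, hΓ⟩ : Γ) ∈ ({1} : Set Γ) := by rw [← hU1]; exact hMU
  exact congrArg Subtype.val this

lemma exists_isSeparationConst (Γ : Subgroup G) (hdisc : DiscreteTopology Γ)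
    (hcomp : CompactSpace (X Γ)) : ∃ σ, IsSeparationConst Γ σ := by
  obtain ⟨n, hn, hrep⟩ := exists_bounded_representatives Γ hcomp
  obtain ⟨η, hη, hgap⟩ := exists_entry_gap Γ hdisc
  -- conjugation by a matrix with entries at most `n` enlarges the distance to the identity
  -- matrix at most by the factor `4 n ^ 2`
  set ρ : ℝ := η / (8 * n ^ 2) with hρ
  have hρ0 : 0 < ρ := by positivity
  set σ : ℝ := Real.log (1 + ρ ^ 2) / 4 with hσ
  have hlog : 0 < Real.log (1 + ρ ^ 2) := Real.log_pos (by nlinarith [sq_nonneg ρ, pow_pos hρ0 2])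
  refine ⟨σ, by positivity, fun γ hγ hne g => ?_⟩
  by_contra! hle
  obtain ⟨δ, hδ, K, hK, rfl⟩ := hrep g
  obtain ⟨l, hl, hp⟩ := exists_hasPath_lt (show dG (γ * (δ * cls K)) (δ * cls K) <
    Real.log (1 + ρ ^ 2) / 3 by linarith)
  have hp' := hp.symm.mul_left (δ * cls K)⁻¹
  rw [inv_mul_cancel] at hp'
  obtain ⟨R, hR, hb⟩ := exists_entry_bound_of_hasPath hp'
  have hexp : Real.exp (3 * l) - 1 ≤ ρ ^ 2 := by
    have : Real.exp (3 * l) ≤ Real.exp (Real.log (1 + ρ ^ 2)) := Real.exp_le_exp.2 (by linarith)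
    rw [Real.exp_log (by positivity)] at this
    linarith
  have hb2 := hb.trans hexp
  have p1 := sq_nonneg (R.1 0 0 - 1)
  have p2 := sq_nonneg (R.1 0 1)
  have p3 := sq_nonneg (R.1 1 0)
  have p4 := sq_nonneg (R.1 1 1 - 1)
  have b1 : |R.1 0 0 - 1| ≤ ρ := abs_le_of_sq_le_sq (by linarith) hρ0.le
  have b2 : |R.1 0 1| ≤ ρ := abs_le_of_sq_le_sq (by linarith) hρ0.le
  have b3 : |R.1 1 0| ≤ ρ := abs_le_of_sq_le_sq (by linarith) hρ0.le
  have b4 : |R.1 1 1 - 1| ≤ ρ := abs_le_of_sq_le_sq (by linarith) hρ0.le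
  have hcls : cls (K * R * K⁻¹) = δ⁻¹ * γ * δ := by
    rw [cls_mul, cls_mul, cls_inv, hR]
    group
  have h1 : cls (K * R * K⁻¹) = 1 := by
    refine hgap _ ?_ (by rw [hcls]; exact Γ.mul_mem (Γ.mul_mem (Γ.inv_mem hδ) hγ) hδ)
    have hprod : ∀ p q r : ℝ, |p| ≤ n → |q| ≤ ρ → |r| ≤ n → |p * q * r| ≤ n * ρ * n := by
      intro p q r h1 h2 h3
      rw [abs_mul, abs_mul]
      gcongr
    have h4n : 4 * (n * ρ * n) < η := by
      rw [hρ]; field_simp; norm_num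
    have hinv : ∀ i j, |(K⁻¹).1 i j| ≤ n := by
      intro i j
      fin_cases i <;> fin_cases j <;>
        simp [Matrix.adjugate_fin_two, hK]
    have hKK : ∀ i j, K.1 i 0 * (K⁻¹).1 0 j + K.1 i 1 * (K⁻¹).1 1 j = (1 : SL(2, ℝ)).1 i j := by
      intro i j
      rw [← mul_entry, mul_inv_cancel]
    intro i j
    have : (K * R * K⁻¹).1 i j - (1 : SL(2, ℝ)).1 i j =
        K.1 i 0 * (R.1 0 0 - 1) * (K⁻¹).1 0 j + K.1 i 0 * R.1 0 1 * (K⁻¹).1 1 j +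
        K.1 i 1 * R.1 1 0 * (K⁻¹).1 0 j + K.1 i 1 * (R.1 1 1 - 1) * (K⁻¹).1 1 j := by
      rw [← hKK, mul_entry, mul_entry, mul_entry]
      ring
    rw [this]
    refine lt_of_le_of_lt ?_ h4n
    have A1 := hprod _ _ _ (hK i 0) b1 (hinv 0 j)
    have A2 := hprod _ _ _ (hK i 0) b2 (hinv 1 j)
    have A3 := hprod _ _ _ (hK i 1) b3 (hinv 0 j)
    have A4 := hprod _ _ _ (hK i 1) b4 (hinv 1 j)
    have := abs_add_le (K.1 i 0 * (R.1 0 0 - 1) * (K⁻¹).1 0 j + K.1 i 0 * R.1 0 1 * (K⁻¹).1 1 j +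
      K.1 i 1 * R.1 1 0 * (K⁻¹).1 0 j) (K.1 i 1 * (R.1 1 1 - 1) * (K⁻¹).1 1 j)
    have := abs_add_three (K.1 i 0 * (R.1 0 0 - 1) * (K⁻¹).1 0 j)
      (K.1 i 0 * R.1 0 1 * (K⁻¹).1 1 j) (K.1 i 1 * R.1 1 0 * (K⁻¹).1 0 j)
    linarith
  apply hne
  rw [hcls] at h1
  have : γ = δ * (δ⁻¹ * γ * δ) * δ⁻¹ := by group
  rw [this, h1]
  simp

/-! ### Lifting shadowing orbits to the group -/

lemma dG_mul_a_le (g : G) (s t : ℝ) : dG (g * a s) (g * a t) ≤ |t - s| := by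
  have h : g * a t = g * a s * a (t - s) := by rw [mul_assoc, ← a_add, add_sub_cancel]
  rw [h, dG_mul_self_left]
  exact dG_one_a_le _

lemma IsSeparationConst.eq_of_dG_le {Γ : Subgroup G} {σ : ℝ} (hσ : IsSeparationConst Γ σ)
    {κ κ' : G} (hκ : κ ∈ Γ) (hκ' : κ' ∈ Γ) {g : G} (h : dG (κ * g) (κ' * g) ≤ σ) : κ = κ' := by
  by_contra hne
  have := hσ.2 (κ'⁻¹ * κ) (Γ.mul_mem (Γ.inv_mem hκ') hκ)
    (fun h => hne (inv_mul_eq_one.1 h).symm) g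
  rw [← dG_mul_left κ', ← mul_assoc, mul_inv_cancel_left] at this
  exact this.not_ge h

/-- If two orbit segments in the quotient stay close to each other, and at one time this is
witnessed by given lifts, then the same lifts witness it all the time: the element of `Γ` that
realizes the distance is locally constant in time because of the separation. -/
lemma FollowsFor.dG_lt {Γ : Subgroup G} {σ : ℝ} (hσ : IsSeparationConst Γ σ) {δ δ' l : ℝ}
    (hδ : 2 * δ < σ) (hδ' : δ + δ' ≤ σ) {p q : G} (H : FollowsFor Γ δ l (proj Γ p) (proj Γ q))
    {t₀ : ℝ} (ht₀ : t₀ ∈ Set.Icc 0 l) (h₀ : dG (p * a t₀) (q * a t₀) < δ') :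
    ∀ t ∈ Set.Icc 0 l, dG (p * a t) (q * a t) < δ := by
  have hex : ∀ t, ∃ κ ∈ Γ, t ∈ Set.Icc 0 l → dG (p * a t) (κ * (q * a t)) < δ := fun t => by
    by_cases ht : t ∈ Set.Icc 0 l
    · obtain ⟨κ, hκ, h⟩ := exists_dG_lt_of_dX_lt (H t ht)
      exact ⟨κ, hκ, fun _ => h⟩
    · exact ⟨1, Γ.one_mem, fun h => absurd h ht⟩
  choose κ hκ hκd using hex
  set η : ℝ := (σ - 2 * δ) / 2 with hη
  have hη0 : 0 < η := by rw [hη]; linarith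
  have hloc : ∀ t ∈ Set.Icc 0 l, ∀ t' ∈ Set.Icc 0 l, |t - t'| ≤ η → κ t = κ t' := by
    intro t ht t' ht' htt
    refine hσ.eq_of_dG_le (hκ t) (hκ t') (g := q * a t) ?_
    have h1 := hκd t ht
    have h2 := hκd t' ht'
    have h3 := dG_mul_a_le p t t'
    have h4 := dG_mul_a_le (κ t' * q) t' t
    rw [abs_sub_comm] at h3
    rw [mul_assoc, mul_assoc] at h4
    rw [dG_comm] at h1
    linarith [dG_triangle (κ t * (q * a t)) (p * a t) (κ t' * (q * a t)),
      dG_triangle (p * a t) (p * a t') (κ t' * (q * a t)),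
      dG_triangle (p * a t') (κ t' * (q * a t')) (κ t' * (q * a t))]
  have hglob : ∀ n : ℕ, ∀ t ∈ Set.Icc 0 l, ∀ t' ∈ Set.Icc 0 l, |t - t'| ≤ (n + 1) * η →
      κ t = κ t' := by
    intro n
    induction n with
    | zero => intro t ht t' ht' h; exact hloc t ht t' ht' (by simpa using h)
    | succ n ih =>
      intro t ht t' ht' h
      push_cast at h
      have hn : (0 : ℝ) < n + 1 + 1 := by positivity
      -- the point that divides the segment from `t` to `t'` in the ratio `1 : n + 1`
      have hs1 : t - (t + (t' - t) / (n + 1 + 1)) = (t - t') / (n + 1 + 1) := by field_simp; ring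
      have hs2 : t + (t' - t) / (n + 1 + 1) - t' = (t - t') / (n + 1 + 1) * (n + 1) := by
        field_simp; ring
      have hle : |(t - t') / (n + 1 + 1)| ≤ η := by
        rw [abs_div, abs_of_pos hn, div_le_iff₀ hn]; linarith
      have hs : t + (t' - t) / (n + 1 + 1) ∈ Set.Icc 0 l := by
        have : t + (t' - t) / (n + 1 + 1) = (1 - 1 / (n + 1 + 1)) * t + 1 / (n + 1 + 1) * t' := by
          field_simp; ring
        rw [this]
        have h1 : (1 : ℝ) / (n + 1 + 1) ≤ 1 := by
          rw [div_le_one hn]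
          linarith [(Nat.cast_nonneg n : (0 : ℝ) ≤ n)]
        exact (convex_Icc (0 : ℝ) l) ht ht' (sub_nonneg.2 h1) (by positivity) (sub_add_cancel _ _)
      refine (hloc t ht _ hs (by rwa [hs1])).trans (ih _ hs t' ht' ?_)
      rw [hs2, abs_mul, abs_of_pos (show (0 : ℝ) < n + 1 by positivity), mul_comm]
      gcongr
  have hone : κ t₀ = 1 := by
    refine hσ.eq_of_dG_le (hκ t₀) Γ.one_mem (g := q * a t₀) ?_
    have h1 := hκd t₀ ht₀
    rw [dG_comm] at h1
    rw [one_mul]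
    linarith [dG_triangle (κ t₀ * (q * a t₀)) (p * a t₀) (q * a t₀)]
  intro t ht
  obtain ⟨n, hn⟩ := exists_nat_gt (|t - t₀| / η)
  have h1 := hκd t ht
  rwa [hglob n t ht t₀ ht₀ (by
    rw [div_lt_iff₀ hη0] at hn
    linarith), hone, one_mul] at h1

/-- If the same element of the group translates two flow lines along themselves, by positive
amounts, then the amounts and the flow lines agree. -/
lemma eq_of_mul_eq_mul_a {η h₁ h₂ : G} {T₁ T₂ : ℝ} (hT₁ : 0 < T₁) (hT₂ : 0 < T₂)
    (H₁ : η * h₁ = h₁ * a T₁) (H₂ : η * h₂ = h₂ * a T₂) :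
    T₁ = T₂ ∧ ∃ τ, h₂ = h₁ * a τ := by
  obtain ⟨K, hK⟩ := exists_cls (h₁⁻¹ * h₂)
  have hconj : a T₁ * cls K = cls K * a T₂ := by
    have : η = h₁ * a T₁ * h₁⁻¹ := by rw [← H₁]; group
    rw [this] at H₂
    rw [hK, mul_assoc, ← H₂]
    group
  have e1 : 1 < Real.exp (T₁ / 2) := Real.one_lt_exp_iff.2 (by linarith)
  have e2 : 1 < Real.exp (T₂ / 2) := Real.one_lt_exp_iff.2 (by linarith)
  have f1 : Real.exp (-(T₁ / 2)) < 1 := Real.exp_lt_one_iff.2 (by linarith)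
  have f2 : Real.exp (-(T₂ / 2)) < 1 := Real.exp_lt_one_iff.2 (by linarith)
  have g1 := Real.exp_pos (-(T₁ / 2))
  have g2 := Real.exp_pos (-(T₂ / 2))
  have hdet := det_entries K
  have ent : ∀ M N : SL(2, ℝ), M = N → ∀ i j, M.1 i j = N.1 i j := fun M N h i j => by rw [h]
  rcases cls_eq_cls_iff.1 hconj with h | h
  · have h00 := ent _ _ h 0 0
    have h01 := ent _ _ h 0 1
    have h10 := ent _ _ h 1 0
    simp [mul_entry, coe_matA] at h00 h01 h10
    have k01 : K.1 0 1 = 0 := by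
      have : K.1 0 1 * (Real.exp (T₁ / 2) - Real.exp (-(T₂ / 2))) = 0 := by linarith
      exact (mul_eq_zero.1 this).resolve_right (by linarith)
    have k10 : K.1 1 0 = 0 := by
      have : K.1 1 0 * (Real.exp (T₂ / 2) - Real.exp (-(T₁ / 2))) = 0 := by linarith
      exact (mul_eq_zero.1 this).resolve_right (by linarith)
    rw [k01, zero_mul, sub_zero] at hdet
    have k00 : K.1 0 0 ≠ 0 := fun h => by simp [h] at hdet
    have hT : Real.exp (T₁ / 2) = Real.exp (T₂ / 2) :=
      mul_right_cancel₀ k00 (h00.trans (mul_comm _ _))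
    refine ⟨by linarith [Real.exp_injective hT], 2 * Real.log |K.1 0 0|, ?_⟩
    have hp : 0 < |K.1 0 0| := abs_pos.2 k00
    have q1 : (matA (2 * Real.log |K.1 0 0|)).1 = !![|K.1 0 0|, 0; 0, |K.1 0 0|⁻¹] := by
      rw [coe_matA, mul_div_cancel_left₀ _ two_ne_zero, Real.exp_neg, Real.exp_log hp]
    have q2 : K.1 1 1 = (K.1 0 0)⁻¹ := eq_inv_of_mul_eq_one_right hdet
    rw [← inv_mul_eq_iff_eq_mul, ← hK, a, cls_eq_cls_iff]
    rcases abs_cases (K.1 0 0) with ⟨ha, -⟩ | ⟨ha, -⟩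
    · left
      refine sl_ext ?_ ?_ ?_ ?_ <;> rw [q1] <;> simp [ha, k01, k10, q2]
    · right
      refine sl_ext ?_ ?_ ?_ ?_ <;>
        rw [Matrix.SpecialLinearGroup.coe_neg, Matrix.neg_apply, q1] <;>
        simp [ha, k01, k10, q2, inv_neg]
  · have h00 := ent _ _ h 0 0
    have h01 := ent _ _ h 0 1
    simp [mul_entry, coe_matA, Matrix.mul_apply] at h00 h01
    have k00 : K.1 0 0 = 0 := by
      have : K.1 0 0 * (Real.exp (T₁ / 2) + Real.exp (T₂ / 2)) = 0 := by linarith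
      exact (mul_eq_zero.1 this).resolve_right (by linarith)
    have k01 : K.1 0 1 = 0 := by
      have : K.1 0 1 * (Real.exp (T₁ / 2) + Real.exp (-(T₂ / 2))) = 0 := by linarith
      exact (mul_eq_zero.1 this).resolve_right (by linarith)
    simp [k00, k01] at hdet

lemma orbit_eq_of_mul_eq_mul_a (Γ : Subgroup G) {η h₁ h₂ : G} {T₁ T₂ : ℝ} (hT₁ : 0 < T₁)
    (hT₂ : 0 < T₂) (H₁ : η * h₁ = h₁ * a T₁) (H₂ : η * h₂ = h₂ * a T₂) :
    T₁ = T₂ ∧ orbit Γ (proj Γ h₁) = orbit Γ (proj Γ h₂) := by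
  obtain ⟨hT, τ, rfl⟩ := eq_of_mul_eq_mul_a hT₁ hT₂ H₁ H₂
  exact ⟨hT, (orbit_eq_of_mem ⟨τ, rfl⟩).symm⟩

lemma exists_mul_a_eq_of_flow_eq {Γ : Subgroup G} {T : ℝ} {g : G}
    (h : flow Γ T (proj Γ g) = proj Γ g) : ∃ γ ∈ Γ, g * a T = γ * g :=
  proj_eq_proj_iff.1 h.symm

/-- Any number well below a separation constant is an expansivity constant. -/
lemma IsSeparationConst.isExpansivityConst {Γ : Subgroup G} {σ : ℝ}
    (hσ : IsSeparationConst Γ σ) {e : ℝ} (he : 0 < e) (he' : 4 * e ≤ σ) :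
    IsExpansivityConst Γ e := by
  refine ⟨he, fun ε hε hεe x₁ x₂ T₁ T₂ hT₁ hT₂ hx₁ hx₂ hT hclose => ?_⟩
  have hm : 0 ≤ min T₁ T₂ := (lt_min hT₁ hT₂).le
  obtain ⟨g₁, rfl⟩ := exists_proj x₁
  obtain ⟨g, rfl⟩ := exists_proj x₂
  have h0 := hclose 0 ⟨le_rfl, hm⟩
  rw [flow_zero, flow_zero] at h0
  obtain ⟨κ, hκ, h0⟩ := exists_dG_lt_of_dX_lt h0
  rw [← proj_mul_left hκ g] at hx₂ hclose ⊢
  set g₂ := κ * g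
  have hall := FollowsFor.dG_lt hσ (δ' := ε) (by linarith) (by linarith) hclose
    (t₀ := 0) ⟨le_rfl, hm⟩ (by simpa [a_zero] using h0)
  have hend := hall _ ⟨hm, le_rfl⟩
  obtain ⟨γ₁, hγ₁, e₁⟩ := exists_mul_a_eq_of_flow_eq hx₁
  obtain ⟨γ₂, hγ₂, e₂⟩ := exists_mul_a_eq_of_flow_eq hx₂
  have hγ : γ₁ = γ₂ := by
    refine hσ.eq_of_dG_le hγ₁ hγ₂ (g := g₁) ?_
    have k1 := dG_mul_a_le g₁ T₁ (min T₁ T₂)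
    have k2 := dG_mul_a_le g₂ (min T₁ T₂) T₂
    have k3 : |min T₁ T₂ - T₁| + |T₂ - min T₁ T₂| = |T₁ - T₂| := by
      rcases le_total T₁ T₂ with h | h
      · rw [min_eq_left h, sub_self, abs_zero, zero_add, abs_sub_comm]
      · rw [min_eq_right h, sub_self, abs_zero, add_zero, abs_sub_comm]
    have k4 : Real.sqrt 2 ≤ 2 := Real.sqrt_le_iff.2 ⟨by norm_num, by norm_num⟩
    have k5 : Real.sqrt 2 * ε ≤ 2 * ε := by gcongr
    have k6 : dG (γ₂ * g₂) (γ₂ * g₁) < ε := by rw [dG_mul_left, dG_comm]; exact h0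
    rw [e₁] at k1
    rw [e₂] at k2
    linarith [dG_triangle (γ₁ * g₁) (g₁ * a (min T₁ T₂)) (γ₂ * g₁),
      dG_triangle (g₁ * a (min T₁ T₂)) (g₂ * a (min T₁ T₂)) (γ₂ * g₁),
      dG_triangle (g₂ * a (min T₁ T₂)) (γ₂ * g₂) (γ₂ * g₁)]
  exact orbit_eq_of_mul_eq_mul_a Γ hT₁ hT₂ e₁.symm (hγ ▸ e₂.symm)

/-! ### The deck transformation of a partner orbit -/

/-- An orbit that follows the four reconnected stretches is translated along itself by an element
of `Γ` that only depends on the given orbit. Here `A` and `B` describe how the two encounters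
close up in `Γ`, and `C` is the deck transformation of the given orbit. -/
lemma exists_lift_of_differsInBoth {Γ : Subgroup G} {σ : ℝ} (hσ : IsSeparationConst Γ σ)
    {ε : ℝ} (hεσ : 84 * ε ≤ σ) {T₁ T₂ T₃ T₄ : ℝ} (hT₁ : 0 < T₁) (hT₂ : 0 < T₂) (hT₃ : 0 < T₃)
    (hT₄ : 0 < T₄) {g e₁ e₂ A B C : G} (hA : A ∈ Γ) (hB : B ∈ Γ) (hC : C ∈ Γ)
    (he₁ : dG 1 e₁ ≤ 2 * ε) (he₂ : dG 1 e₂ ≤ 2 * ε)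
    (hAg : g * a T₂ * dPi = A * g * e₁)
    (hBg : g * a (-T₁) * e₂ = B * g * a (T₂ + T₃) * dPi)
    (hCg : g * a (T₁ + T₂ + T₃ + T₄) = C * g)
    {T : ℝ} {O : Set (X Γ)} (hO : IsPeriodicOrbit Γ T O)
    (H : DiffersInBoth Γ (20 * ε) (proj Γ (g * a (-T₁))) (proj Γ g) (proj Γ (g * a T₂))
      (proj Γ (g * a (T₂ + T₃))) T₁ T₂ T₃ T₄ T O) :
    ∃ h : G, O = orbit Γ (proj Γ h) ∧ A * B * C * B * A * h = h * a T := by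
  obtain ⟨v, hv, r₁, r₂, r₃, r₄, -, -, -, -, hr, hr₁, hr₂, hr₃, hr₄, F₂, F₁, F₄, F₃⟩ := H
  obtain ⟨hT, o, ho, rfl⟩ := hO
  have hvT := flow_eq_self_of_mem_orbit ho hv
  rw [← orbit_eq_of_mem hv]
  have hσ0 := hσ.1
  have hε : 0 < ε := by linarith [abs_nonneg (r₁ - T₁)]
  -- the stretch from `y` to `z` determines the lift
  obtain ⟨h', rfl⟩ := exists_proj v
  have h0 := F₂ 0 ⟨le_rfl, hT₂.le⟩
  rw [flow_zero, flow_zero] at h0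
  obtain ⟨κ, hκ, h0⟩ := exists_dG_lt_of_dX_lt h0
  rw [← proj_mul_left hκ h'] at F₁ F₂ F₃ F₄ hvT ⊢
  set h := κ * h'
  have S₁ := F₂.dG_lt hσ (δ' := 20 * ε) (by linarith) (by linarith)
    (t₀ := 0) ⟨le_rfl, hT₂.le⟩ (by simpa [a_zero] using h0) T₂ ⟨hT₂.le, le_rfl⟩
  -- the stretch from `x` to `y`, run backwards
  rw [flow_proj, rev_proj, ← proj_mul_left hA, ← mul_assoc] at F₁
  have S₂ : dG (A * g * a (-T₁)) (h * a (r₂ + r₁) * dPi) < 20 * ε := by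
    have := F₁.dG_lt hσ (δ' := 62 * ε) (by linarith) (by linarith)
      (t₀ := T₁) ⟨hT₁.le, le_rfl⟩ ?_ 0 ⟨le_rfl, hT₁.le⟩
    · simpa [a_zero] using this
    have k1 : A * g * a (-T₁) * a T₁ = A * g := by
      rw [mul_assoc, ← a_add, neg_add_cancel, a_zero, mul_one]
    have k2 : h * a (r₂ + r₁) * dPi * a T₁ = h * a (r₂ + r₁ - T₁) * dPi := by
      rw [mul_assoc, dPi_mul_a, ← mul_assoc, mul_assoc h, ← a_add, sub_eq_add_neg]
    have k3 : dG (A * g) (A * g * e₁) ≤ 2 * ε := by rwa [dG_mul_self_left]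
    have k4 : dG (A * g * e₁) (h * a T₂ * dPi) < 20 * ε := by rwa [← hAg, dG_mul_dPi]
    have k5 : dG (h * a T₂ * dPi) (h * a (r₂ + r₁ - T₁) * dPi) < 40 * ε := by
      rw [dG_mul_dPi]
      refine (dG_mul_a_le _ _ _).trans_lt ?_
      rw [show r₂ + r₁ - T₁ - T₂ = (r₂ - T₂) + (r₁ - T₁) by ring]
      linarith [abs_add_le (r₂ - T₂) (r₁ - T₁)]
    rw [k1, k2]
    linarith [dG_triangle (A * g) (A * g * e₁) (h * a (r₂ + r₁ - T₁) * dPi),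
      dG_triangle (A * g * e₁) (h * a T₂ * dPi) (h * a (r₂ + r₁ - T₁) * dPi)]
  -- the stretch from `w` to `x`
  have hBg' : B * g * a (T₂ + T₃) = g * a (-T₁) * e₂ * dPi := by
    rw [hBg, mul_assoc (B * g * a (T₂ + T₃)), dPi_mul_dPi, mul_one]
  rw [flow_proj, ← proj_mul_left (Γ.mul_mem hA hB)] at F₄
  have S₃ : dG (A * B * (g * a (T₂ + T₃)) * a T₄) (h * a (r₂ + r₁) * a T₄) < 20 * ε := by
    refine F₄.dG_lt hσ (δ' := 62 * ε) (by linarith) (by linarith)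
      (t₀ := 0) ⟨le_rfl, hT₄.le⟩ ?_ T₄ ⟨hT₄.le, le_rfl⟩
    have k1 : A * B * (g * a (T₂ + T₃)) = A * g * a (-T₁) * e₂ * dPi := by
      simp only [mul_assoc] at hBg' ⊢
      rw [hBg']
    have k2 : h * a (r₂ + r₁) = h * a (r₂ + r₁) * dPi * dPi := by
      rw [mul_assoc (h * a (r₂ + r₁)), dPi_mul_dPi, mul_one]
    rw [a_zero, mul_one, mul_one, k1, k2, dG_mul_dPi]
    have k3 : dG (A * g * a (-T₁) * e₂) (A * g * a (-T₁)) ≤ 2 * ε := by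
      rwa [dG_comm, dG_mul_self_left]
    linarith [dG_triangle (A * g * a (-T₁) * e₂) (A * g * a (-T₁)) (h * a (r₂ + r₁) * dPi)]
  -- the stretch from `z` to `w`, run backwards
  rw [flow_proj, rev_proj, ← proj_mul_left (Γ.mul_mem (Γ.mul_mem (Γ.mul_mem hA hB) hC) hB)] at F₃
  have S₄ : dG (A * B * C * B * (g * a T₂)) (h * a T * dPi) < 20 * ε := by
    have := F₃.dG_lt hσ (δ' := 62 * ε) (by linarith) (by linarith)
      (t₀ := T₃) ⟨hT₃.le, le_rfl⟩ ?_ 0 ⟨le_rfl, hT₃.le⟩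
    · simpa [a_zero] using this
    have k0 : C * (g * a (-T₁)) = g * a (T₂ + T₃) * a T₄ := by
      rw [← mul_assoc, ← hCg, mul_assoc, ← a_add, mul_assoc, ← a_add]
      congr 2
      ring
    have k1 : A * B * C * B * (g * a T₂) * a T₃ =
        A * B * (g * a (T₂ + T₃)) * a T₄ * e₂ * dPi := by
      have : A * B * C * B * (g * a T₂) * a T₃ = A * B * C * (B * g * a (T₂ + T₃)) := by
        simp only [mul_assoc, a_add]
      rw [this, hBg']
      have : A * B * C * (g * a (-T₁) * e₂ * dPi) = A * B * (C * (g * a (-T₁))) * e₂ * dPi := by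
        simp only [mul_assoc]
      rw [this, k0]
      simp only [mul_assoc]
    have k2 : h * a T * dPi * a T₃ = h * a (T - T₃) * dPi := by
      rw [mul_assoc, dPi_mul_a, ← mul_assoc, mul_assoc h, ← a_add, sub_eq_add_neg]
    have k3 : dG (A * B * (g * a (T₂ + T₃)) * a T₄ * e₂) (A * B * (g * a (T₂ + T₃)) * a T₄) ≤
        2 * ε := by
      rwa [dG_comm, dG_mul_self_left]
    have k4 : dG (h * a (r₂ + r₁) * a T₄) (h * a (T - T₃)) < 40 * ε := by
      rw [mul_assoc, ← a_add]
      refine (dG_mul_a_le _ _ _).trans_lt ?_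
      rw [show T - T₃ - (r₂ + r₁ + T₄) = (r₄ - T₄) + (r₃ - T₃) by linarith]
      linarith [abs_add_le (r₄ - T₄) (r₃ - T₃)]
    rw [k1, k2, dG_mul_dPi]
    linarith [dG_triangle (A * B * (g * a (T₂ + T₃)) * a T₄ * e₂)
        (A * B * (g * a (T₂ + T₃)) * a T₄) (h * a (T - T₃)),
      dG_triangle (A * B * (g * a (T₂ + T₃)) * a T₄) (h * a (r₂ + r₁) * a T₄) (h * a (T - T₃))]
  refine ⟨h, rfl, ?_⟩
  obtain ⟨γ, hγ, hγh⟩ := exists_mul_a_eq_of_flow_eq hvT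
  rw [hγh]
  congr 1
  refine hσ.eq_of_dG_le (Γ.mul_mem (Γ.mul_mem (Γ.mul_mem (Γ.mul_mem hA hB) hC) hB) hA) hγ
    (g := h) ?_
  have hAg' : g * a T₂ = A * g * e₁ * dPi := by
    rw [← hAg, mul_assoc (g * a T₂), dPi_mul_dPi, mul_one]
  have k1 : A * B * C * B * (g * a T₂) = A * B * C * B * A * g * e₁ * dPi := by
    rw [hAg']
    simp only [mul_assoc]
  rw [k1, dG_mul_dPi, hγh] at S₄
  have k2 : dG (A * B * C * B * A * h) (A * B * C * B * A * g) < 20 * ε := by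
    rwa [dG_mul_left, dG_comm]
  have k3 : dG (A * B * C * B * A * g) (A * B * C * B * A * g * e₁) ≤ 2 * ε := by
    rwa [dG_mul_self_left]
  linarith [dG_triangle (A * B * C * B * A * h) (A * B * C * B * A * g) (γ * h),
    dG_triangle (A * B * C * B * A * g) (A * B * C * B * A * g * e₁) (γ * h)]

/-! ### Cycles of Möbius maps close to the identity -/

lemma mobius_bound_of_den {ε ρ R p b c x : ℝ} (hε : 0 < ε) (hε2 : ε ^ 2 ≤ 1 / 30)
    (hp : |p - 1| ≤ ε ^ 2) (hb : |b| ≤ ε) (hc : |c| ≤ ε) (hx : |x| ≤ ρ * ε)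
    (hρ : 1 + ρ < 30) (hR : 1 + ρ ≤ R * (1 - (1 + ρ) / 30)) :
    0 < p + c * x ∧ |(x + b) / (p + c * x)| ≤ R * ε := by
  have hρ0 : 0 ≤ ρ := nonneg_of_mul_nonneg_left ((abs_nonneg x).trans hx) hε
  have hR0 : 0 ≤ R := by
    by_contra! h
    nlinarith
  have hcx : |c * x| ≤ ρ * ε ^ 2 := by
    rw [abs_mul]
    calc _ ≤ ε * (ρ * ε) := by gcongr
      _ = _ := by ring
  have hden : 1 - (1 + ρ) / 30 ≤ p + c * x := by
    have := mul_le_mul_of_nonneg_left hε2 hρ0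
    linarith [(abs_le.1 hp).1, (abs_le.1 hcx).1]
  have hpos : 0 < p + c * x := by linarith
  refine ⟨hpos, ?_⟩
  rw [abs_div, abs_of_pos hpos, div_le_iff₀ hpos]
  calc |x + b| ≤ (1 + ρ) * ε := by linarith [abs_add_le x b]
    _ ≤ R * (1 - (1 + ρ) / 30) * ε := by gcongr
    _ ≤ R * (p + c * x) * ε := by gcongr
    _ = _ := by ring

lemma mobius_bound_of_num {ε ρ R p b c x : ℝ} (hε : 0 < ε) (hε2 : ε ^ 2 ≤ 1 / 30)
    (hp : |p - 1| ≤ ε ^ 2) (hb : |b| ≤ ε) (hc : |c| ≤ ε) (hx : |x| ≤ ρ * ε)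
    (hρ : ρ < 30) (hR : 1 + 31 / 30 * ρ ≤ R * (1 - ρ / 30)) :
    0 < 1 + c * x ∧ |(p * x + b) / (1 + c * x)| ≤ R * ε := by
  have hρ0 : 0 ≤ ρ := nonneg_of_mul_nonneg_left ((abs_nonneg x).trans hx) hε
  have hR0 : 0 ≤ R := by
    by_contra! h
    nlinarith
  have hcx : |c * x| ≤ ρ * ε ^ 2 := by
    rw [abs_mul]
    calc _ ≤ ε * (ρ * ε) := by gcongr
      _ = _ := by ring
  have hden : 1 - ρ / 30 ≤ 1 + c * x := by
    have := mul_le_mul_of_nonneg_left hε2 hρ0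
    linarith [(abs_le.1 hcx).1]
  have hpos : 0 < 1 + c * x := by linarith
  have hp' : |p| ≤ 31 / 30 := by
    rw [abs_le] at hp ⊢
    constructor <;> linarith
  refine ⟨hpos, ?_⟩
  rw [abs_div, abs_of_pos hpos, div_le_iff₀ hpos]
  calc |p * x + b| ≤ |p| * |x| + |b| := by rw [← abs_mul]; exact abs_add_le _ _
    _ ≤ 31 / 30 * (ρ * ε) + ε := by gcongr
    _ = (1 + 31 / 30 * ρ) * ε := by ring
    _ ≤ R * (1 - ρ / 30) * ε := by gcongr
    _ ≤ R * (1 + c * x) * ε := by gcongr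
    _ = _ := by ring

/-- A cyclic composition of four Möbius maps close to the identity, interlaced with four
contractions, has a fixed point near `0`; `x₁, …, x₄` are the points of its cycle. Two of the maps
carry the perturbation `p ≈ 1` in the denominator, two of them in the numerator. -/
lemma exists_mobius_cycle {ε : ℝ} (hε : 0 < ε) (hε2 : ε ^ 2 ≤ 1 / 30)
    {p₁ p₂ p₃ p₄ b₁ b₂ b₃ b₄ c₁ c₂ c₃ c₄ q₁ q₂ q₃ q₄ R₁ R₂ R₃ R₄ ρ₁ ρ₂ ρ₃ ρ₄ : ℝ}
    (hp₁ : |p₁ - 1| ≤ ε ^ 2) (hp₂ : |p₂ - 1| ≤ ε ^ 2) (hp₃ : |p₃ - 1| ≤ ε ^ 2)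
    (hp₄ : |p₄ - 1| ≤ ε ^ 2)
    (hb₁ : |b₁| ≤ ε) (hb₂ : |b₂| ≤ ε) (hb₃ : |b₃| ≤ ε) (hb₄ : |b₄| ≤ ε)
    (hc₁ : |c₁| ≤ ε) (hc₂ : |c₂| ≤ ε) (hc₃ : |c₃| ≤ ε) (hc₄ : |c₄| ≤ ε)
    (hq₁ : 0 < q₁) (hq₂ : 0 < q₂) (hq₃ : 0 < q₃) (hq₄ : 0 < q₄)
    (hρ₁ : q₁ * R₁ ≤ ρ₁) (hρ₂ : q₂ * R₂ ≤ ρ₂) (hρ₃ : q₃ * R₃ ≤ ρ₃) (hρ₄ : q₄ * R₄ ≤ ρ₄)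
    (hρ₁' : ρ₁ < 29) (hρ₂' : ρ₂ < 29) (hρ₃' : ρ₃ < 29) (hρ₄' : ρ₄ < 29) (hρ₄0 : 0 ≤ ρ₄)
    (hR₁ : 1 + ρ₄ ≤ R₁ * (1 - (1 + ρ₄) / 30)) (hR₂ : 1 + 31 / 30 * ρ₁ ≤ R₂ * (1 - ρ₁ / 30))
    (hR₃ : 1 + ρ₂ ≤ R₃ * (1 - (1 + ρ₂) / 30)) (hR₄ : 1 + 31 / 30 * ρ₃ ≤ R₄ * (1 - ρ₃ / 30)) :
    ∃ x₁ x₂ x₃ x₄ : ℝ, |x₁| ≤ R₁ * ε ∧ |x₂| ≤ R₂ * ε ∧ |x₃| ≤ R₃ * ε ∧ |x₄| ≤ R₄ * ε ∧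
      x₁ * (p₁ + c₁ * (q₄ * x₄)) = q₄ * x₄ + b₁ ∧ x₂ * (1 + c₂ * (q₁ * x₁)) = p₂ * (q₁ * x₁) + b₂ ∧
      x₃ * (p₃ + c₃ * (q₂ * x₂)) = q₂ * x₂ + b₃ ∧
      x₄ * (1 + c₄ * (q₃ * x₃)) = p₄ * (q₃ * x₃) + b₄ := by
  set f₁ : ℝ → ℝ := fun y => (y + b₁) / (p₁ + c₁ * y)
  set f₂ : ℝ → ℝ := fun y => (p₂ * y + b₂) / (1 + c₂ * y)
  set f₃ : ℝ → ℝ := fun y => (y + b₃) / (p₃ + c₃ * y)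
  set f₄ : ℝ → ℝ := fun y => (p₄ * y + b₄) / (1 + c₄ * y)
  have scale : ∀ {q R ρ x : ℝ}, 0 < q → q * R ≤ ρ → |x| ≤ R * ε → |q * x| ≤ ρ * ε := by
    intro q R ρ x hq hqR hx
    rw [abs_mul, abs_of_pos hq]
    calc q * |x| ≤ q * (R * ε) := by gcongr
      _ = q * R * ε := by ring
      _ ≤ _ := by gcongr
  have F₁ : ∀ y, |y| ≤ ρ₄ * ε → 0 < p₁ + c₁ * y ∧ |f₁ y| ≤ R₁ * ε := fun y hy =>
    mobius_bound_of_den hε hε2 hp₁ hb₁ hc₁ hy (by linarith) hR₁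
  have F₂ : ∀ y, |y| ≤ ρ₁ * ε → 0 < 1 + c₂ * y ∧ |f₂ y| ≤ R₂ * ε := fun y hy =>
    mobius_bound_of_num hε hε2 hp₂ hb₂ hc₂ hy (by linarith) hR₂
  have F₃ : ∀ y, |y| ≤ ρ₂ * ε → 0 < p₃ + c₃ * y ∧ |f₃ y| ≤ R₃ * ε := fun y hy =>
    mobius_bound_of_den hε hε2 hp₃ hb₃ hc₃ hy (by linarith) hR₃
  have F₄ : ∀ y, |y| ≤ ρ₃ * ε → 0 < 1 + c₄ * y ∧ |f₄ y| ≤ R₄ * ε := fun y hy =>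
    mobius_bound_of_num hε hε2 hp₄ hb₄ hc₄ hy (by linarith) hR₄
  set g₁ : ℝ → ℝ := fun y => q₁ * f₁ y
  set g₂ : ℝ → ℝ := fun y => q₂ * f₂ (g₁ y)
  set g₃ : ℝ → ℝ := fun y => q₃ * f₃ (g₂ y)
  set g₄ : ℝ → ℝ := fun y => q₄ * f₄ (g₃ y)
  have G₁ : ∀ y, |y| ≤ ρ₄ * ε → |g₁ y| ≤ ρ₁ * ε := fun y hy => scale hq₁ hρ₁ (F₁ y hy).2
  have G₂ : ∀ y, |y| ≤ ρ₄ * ε → |g₂ y| ≤ ρ₂ * ε := fun y hy =>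
    scale hq₂ hρ₂ (F₂ _ (G₁ y hy)).2
  have G₃ : ∀ y, |y| ≤ ρ₄ * ε → |g₃ y| ≤ ρ₃ * ε := fun y hy =>
    scale hq₃ hρ₃ (F₃ _ (G₂ y hy)).2
  have G₄ : ∀ y, |y| ≤ ρ₄ * ε → |g₄ y| ≤ ρ₄ * ε := fun y hy =>
    scale hq₄ hρ₄ (F₄ _ (G₃ y hy)).2
  have C₁ : ContinuousOn g₁ (Set.Icc (-(ρ₄ * ε)) (ρ₄ * ε)) :=
    continuousOn_const.mul (ContinuousOn.div (by fun_prop) (by fun_prop)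
      fun y hy => (F₁ y (abs_le.2 hy)).1.ne')
  have C₂ : ContinuousOn g₂ (Set.Icc (-(ρ₄ * ε)) (ρ₄ * ε)) :=
    continuousOn_const.mul (ContinuousOn.div (by fun_prop) (by fun_prop)
      fun y hy => (F₂ _ (G₁ y (abs_le.2 hy))).1.ne')
  have C₃ : ContinuousOn g₃ (Set.Icc (-(ρ₄ * ε)) (ρ₄ * ε)) :=
    continuousOn_const.mul (ContinuousOn.div (by fun_prop) (by fun_prop)
      fun y hy => (F₃ _ (G₂ y (abs_le.2 hy))).1.ne')
  have C₄ : ContinuousOn g₄ (Set.Icc (-(ρ₄ * ε)) (ρ₄ * ε)) :=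
    continuousOn_const.mul (ContinuousOn.div (by fun_prop) (by fun_prop)
      fun y hy => (F₄ _ (G₃ y (abs_le.2 hy))).1.ne')
  have hρε : 0 ≤ ρ₄ * ε := by positivity
  obtain ⟨y, hy, hfix⟩ := exists_mem_Icc_isFixedPt_of_mapsTo C₄ (by linarith)
    fun y hy => abs_le.1 (G₄ y (abs_le.2 hy))
  have hy' := abs_le.2 hy
  have hfix' : q₄ * f₄ (g₃ y) = y := hfix
  refine ⟨f₁ y, f₂ (g₁ y), f₃ (g₂ y), f₄ (g₃ y), (F₁ y hy').2, (F₂ _ (G₁ y hy')).2,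
    (F₃ _ (G₂ y hy')).2, (F₄ _ (G₃ y hy')).2, ?_, ?_, ?_, ?_⟩
  · rw [hfix']
    exact div_mul_cancel₀ _ (F₁ y hy').1.ne'
  · exact div_mul_cancel₀ _ (F₂ _ (G₁ y hy')).1.ne'
  · exact div_mul_cancel₀ _ (F₃ _ (G₂ y hy')).1.ne'
  · exact div_mul_cancel₀ _ (F₄ _ (G₃ y hy')).1.ne'

/-! ### Frames -/

/-- The matrix whose columns are proportional to `(1, m)` and `(n, 1)`: a flow line whose
expanding direction has slope `m` and whose contracting direction has inverse slope `n`. It is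
written in the coordinates of a Poincaré section and meaningful for `m * n ≠ 1`. -/
def frame (m n : ℝ) : SL(2, ℝ) := matC m * matB (n / (1 - m * n))

/-- A matrix that maps the directions `(1, m)` to `(1, m')` and `(n, 1)` to `(n', 1)` maps the
corresponding frames to each other up to a shift along the flow. -/
lemma mul_frame {E : SL(2, ℝ)} {m n m' n' : ℝ} (hpos : 0 < E.1 0 0 + E.1 0 1 * m)
    (hm : m' * (E.1 0 0 + E.1 0 1 * m) = E.1 1 0 + E.1 1 1 * m)
    (hn : n * (E.1 0 0 - E.1 1 0 * n') = E.1 1 1 * n' - E.1 0 1)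
    (h₁ : 1 - m * n ≠ 0) (h₂ : 1 - m' * n' ≠ 0) :
    E * frame m n = frame m' n' * matA (2 * Real.log (E.1 0 0 + E.1 0 1 * m)) := by
  have hdet := det_entries E
  have hA : (matA (2 * Real.log (E.1 0 0 + E.1 0 1 * m))).1 =
      !![E.1 0 0 + E.1 0 1 * m, 0; 0, (E.1 0 0 + E.1 0 1 * m)⁻¹] := by
    rw [coe_matA, mul_div_cancel_left₀ _ two_ne_zero, Real.exp_neg, Real.exp_log hpos]
  set P := E.1 0 0
  set Q := E.1 0 1
  set R := E.1 1 0
  set S := E.1 1 1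
  have k1 : (P + Q * m) * (1 - m' * n') = (P - R * n') * (1 - m * n) := by
    linear_combination -n' * hm + m * hn
  have hκ : P - R * n' ≠ 0 := fun h => by
    rw [h, zero_mul] at k1
    exact mul_ne_zero hpos.ne' h₂ k1
  have k2 : (P * n + Q) * (P - R * n') = n' := by linear_combination P * hn + n' * hdet
  have k3 : (R * n + S) * (P - R * n') = 1 := by linear_combination R * hn + hdet
  have s₁ : n / (1 - m * n) * (1 - m * n) = n := div_mul_cancel₀ _ h₁
  have j1 : P * (n / (1 - m * n)) + Q * (m * (n / (1 - m * n)) + 1) =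
      n' / (1 - m' * n') * (P + Q * m)⁻¹ := by
    have e : n' / (1 - m' * n') * (P + Q * m)⁻¹ = n' / ((P + Q * m) * (1 - m' * n')) := by
      have := hpos.ne'
      field_simp
    rw [e, k1, eq_div_iff (mul_ne_zero hκ h₁)]
    linear_combination k2 + (P - R * n') * (P + Q * m) * s₁
  have j2 : R * (n / (1 - m * n)) + S * (m * (n / (1 - m * n)) + 1) =
      (m' * (n' / (1 - m' * n')) + 1) * (P + Q * m)⁻¹ := by
    have e : (m' * (n' / (1 - m' * n')) + 1) * (P + Q * m)⁻¹ =
        1 / ((P + Q * m) * (1 - m' * n')) := by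
      have := hpos.ne'
      field_simp
      ring
    rw [e, k1, eq_div_iff (mul_ne_zero hκ h₁)]
    linear_combination k3 + (P - R * n') * (R + S * m) * s₁
  refine sl_ext ?_ ?_ ?_ ?_ <;>
    simp only [frame, mul_entry, hA, coe_matB, coe_matC, Matrix.of_apply, Matrix.cons_val',
      Matrix.cons_val_zero, Matrix.cons_val_one, Matrix.cons_val_fin_one]
  · ring
  · linear_combination j1
  · linear_combination -hm
  · linear_combination j2

lemma matA_mul_frame (T m n : ℝ) :
    matA T * frame m (Real.exp (-T) * n) = frame (Real.exp (-T) * m) n * matA T := by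
  have e : Real.exp (-T) = Real.exp (-(T / 2)) * Real.exp (-(T / 2)) := by
    rw [← Real.exp_add]; ring_nf
  have e' : Real.exp (T / 2) * Real.exp (-(T / 2)) = 1 := by rw [← Real.exp_add]; simp
  have h : m * (Real.exp (-T) * n) = Real.exp (-T) * m * n := by ring
  rw [frame, frame, h, mul_div_assoc]
  set k := n / (1 - Real.exp (-T) * m * n)
  rw [e]
  refine sl_ext ?_ ?_ ?_ ?_ <;>
    simp only [mul_entry, coe_matA, coe_matB, coe_matC, Matrix.of_apply, Matrix.cons_val',
      Matrix.cons_val_zero, Matrix.cons_val_one, Matrix.cons_val_fin_one]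
  · ring
  · linear_combination Real.exp (-(T / 2)) * k * e'
  · linear_combination -Real.exp (-(T / 2)) * m * e'
  · ring

lemma abs_frame_coord_le {m n : ℝ} (h : |m * n| ≤ 1 / 2) : |n / (1 - m * n)| ≤ 2 * |n| := by
  have : 1 / 2 ≤ 1 - m * n := by linarith [(abs_le.1 h).2]
  rw [abs_div, abs_of_pos (by linarith : 0 < 1 - m * n), div_le_iff₀ (by linarith)]
  nlinarith [abs_nonneg n]

lemma abs_log_add_sub_log_le {p x : ℝ} (hp : 0 < p) (hx : |x| ≤ p / 2) :
    |Real.log (p + x) - Real.log p| ≤ 2 * |x| / p := by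
  have hpx : 0 < p + x := by linarith [(abs_le.1 hx).1]
  rw [← Real.log_div hpx.ne' hp.ne']
  have h1 := Real.log_le_sub_one_of_pos (div_pos hpx hp)
  have h2 := Real.one_sub_inv_le_log_of_pos (div_pos hpx hp)
  rw [abs_le]
  constructor
  · refine le_trans ?_ h2
    rw [inv_div, one_sub_div hpx.ne', add_sub_cancel_left, neg_le, ← neg_div,
      div_le_div_iff₀ hpx hp]
    have : p / 2 ≤ p + x := by linarith [(abs_le.1 hx).1]
    nlinarith [neg_abs_le x, abs_nonneg x, mul_le_mul_of_nonneg_left this (abs_nonneg x)]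
  · refine h1.trans ?_
    rw [div_sub_one hp.ne', add_sub_cancel_left]
    gcongr
    linarith [le_abs_self x, abs_nonneg x]

lemma b_mul_c_mul_frame {s u m n m' n' : ℝ} (hpos : 0 < 1 + s * u + s * m)
    (hm : m' * (1 + s * u + s * m) = m + u) (hn : n * (1 + s * u - u * n') = n' - s)
    (h₁ : 1 - m * n ≠ 0) (h₂ : 1 - m' * n' ≠ 0) :
    b s * c u * cls (frame m n) = cls (frame m' n') * a (2 * Real.log (1 + s * u + s * m)) := by
  have e00 : (matB s * matC u).1 0 0 = 1 + s * u := by simp [mul_entry, coe_matB, coe_matC]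
  have e01 : (matB s * matC u).1 0 1 = s := by simp [mul_entry, coe_matB, coe_matC]
  have e10 : (matB s * matC u).1 1 0 = u := by simp [mul_entry, coe_matB, coe_matC]
  have e11 : (matB s * matC u).1 1 1 = 1 := by simp [mul_entry, coe_matB, coe_matC]
  have h := mul_frame (E := matB s * matC u) (m := m) (n := n) (m' := m') (n' := n')
    (by rwa [e00, e01]) (by rw [e00, e01, e10, e11, hm]; ring)
    (by rw [e00, e01, e10, e11, hn]; ring) h₁ h₂
  rw [e00, e01] at h
  exact congrArg cls h

lemma c_mul_b_mul_frame {s u m n m' n' : ℝ} (hpos : 0 < 1 + s * m)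
    (hm : m' * (1 + s * m) = (1 + u * s) * m + u) (hn : n * (1 - u * n') = (1 + u * s) * n' - s)
    (h₁ : 1 - m * n ≠ 0) (h₂ : 1 - m' * n' ≠ 0) :
    c u * b s * cls (frame m n) = cls (frame m' n') * a (2 * Real.log (1 + s * m)) := by
  have e00 : (matC u * matB s).1 0 0 = 1 := by simp [mul_entry, coe_matB, coe_matC]
  have e01 : (matC u * matB s).1 0 1 = s := by simp [mul_entry, coe_matB, coe_matC]
  have e10 : (matC u * matB s).1 1 0 = u := by simp [mul_entry, coe_matB, coe_matC]
  have e11 : (matC u * matB s).1 1 1 = 1 + u * s := by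
    simp [mul_entry, coe_matB, coe_matC, add_comm]
  have h := mul_frame (E := matC u * matB s) (m := m) (n := n) (m' := m') (n' := n')
    (by rwa [e00, e01]) (by rw [e00, e01, e10, e11, hm]; ring) (by rw [e00, e01, e10, e11, hn])
    h₁ h₂
  rw [e00, e01] at h
  exact congrArg cls h

lemma a_mul_frame (T m n : ℝ) : a T * cls (frame m (Real.exp (-T) * n)) =
    cls (frame (Real.exp (-T) * m) n) * a T := congrArg cls (matA_mul_frame T m n)

lemma chain_eq {K : Type*} [Group K] {p E q F₀ F₁ F₂ F₃ p' E' q' : K} (h₁ : q * F₀ = F₁ * q')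
    (h₂ : E * F₁ = F₂ * E') (h₃ : p * F₂ = F₃ * p') :
    p * E * q * F₀ = F₃ * (p' * E' * q') := by
  calc p * E * q * F₀ = p * (E * (q * F₀)) := by simp only [mul_assoc]
    _ = p * (E * F₁) * q' := by rw [h₁]; simp only [mul_assoc]
    _ = p * F₂ * E' * q' := by rw [h₂]; simp only [mul_assoc]
    _ = _ := by rw [h₃]; simp only [mul_assoc]

/-! ### The axis of the reconnected orbit -/

/-- The time shifts picked up in the four encounter jumps are `2 log (p + x)` with `p ≈ 1` and a
perturbation `x` that is exponentially small in the length of a stretch. -/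
lemma shift_estimates {ε q₁ q₂ q₃ q₄ y₁ y₂ x₁ x₂ x₃ x₄ : ℝ} (hε : 0 < ε) (hε2 : ε ^ 2 ≤ 1 / 30)
    (hq₁ : 0 < q₁) (hq₂ : 0 < q₂) (hq₃ : 0 < q₃) (hq₄ : 0 < q₄)
    (hq₁' : q₁ ≤ 1 / 13) (hq₂' : q₂ ≤ 1 / 6) (hq₃' : q₃ ≤ 1 / 3) (hq₄' : q₄ ≤ 1)
    (hy₁ : |y₁| ≤ ε ^ 2) (hy₂ : |y₂| ≤ ε ^ 2)
    (hx₁ : |x₁| ≤ 3 * ε ^ 2 * q₁) (hx₂ : |x₂| ≤ 13 / 10 * ε ^ 2 * q₂)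
    (hx₃ : |x₃| ≤ 8 / 5 * ε ^ 2 * q₃) (hx₄ : |x₄| ≤ 8 / 5 * ε ^ 2 * q₄) :
    (0 < 1 + y₂ + x₄ ∧ 0 < 1 + x₁ ∧ 0 < 1 + y₁ + x₂ ∧ 0 < 1 + x₃) ∧
    (|2 * Real.log (1 + y₂ + x₄)| ≤ 11 * ε ^ 2 ∧ |2 * Real.log (1 + x₁)| ≤ ε ^ 2 ∧
      |2 * Real.log (1 + y₁ + x₂)| ≤ 6 * ε ^ 2 ∧ |2 * Real.log (1 + x₃)| ≤ 3 * ε ^ 2) ∧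
    |(2 * Real.log (1 + y₂ + x₄) + 2 * Real.log (1 + x₁) + 2 * Real.log (1 + y₁ + x₂)
        + 2 * Real.log (1 + x₃)) / 2 - Real.log ((1 + y₁) * (1 + y₂))| <
      ε ^ 2 * (21 * q₁ + 30 * q₂ + 12 * q₃ + 19 * q₄) := by
  have hε0 : 0 < ε ^ 2 := by positivity
  have w₁ : ε ^ 2 * q₁ ≤ ε ^ 2 * (1 / 13) := by gcongr
  have w₂ : ε ^ 2 * q₂ ≤ ε ^ 2 * (1 / 6) := by gcongr
  have w₃ : ε ^ 2 * q₃ ≤ ε ^ 2 * (1 / 3) := by gcongr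
  have w₄ : ε ^ 2 * q₄ ≤ ε ^ 2 * 1 := by gcongr
  have P₁ : 29 / 30 ≤ 1 + y₁ := by linarith only [(abs_le.1 hy₁).1, hε2]
  have P₂ : 29 / 30 ≤ 1 + y₂ := by linarith only [(abs_le.1 hy₂).1, hε2]
  have L₁ := abs_log_add_sub_log_le one_pos (x := x₁) (by linarith only [hx₁, w₁, hε2])
  have L₃ := abs_log_add_sub_log_le one_pos (x := x₃) (by linarith only [hx₃, w₃, hε2])
  have L₂ := abs_log_add_sub_log_le (p := 1 + y₁) (by linarith only [P₁]) (x := x₂)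
    (by linarith only [P₁, hx₂, w₂, hε2])
  have L₄ := abs_log_add_sub_log_le (p := 1 + y₂) (by linarith only [P₂]) (x := x₄)
    (by linarith only [P₂, hx₄, w₄, hε2])
  have M₁ := abs_log_add_sub_log_le one_pos (x := y₁) (by linarith only [hy₁, hε2])
  have M₂ := abs_log_add_sub_log_le one_pos (x := y₂) (by linarith only [hy₂, hε2])
  have hdiv : ∀ {x p : ℝ}, 29 / 30 ≤ p → 2 * |x| / p ≤ 60 / 29 * |x| := by
    intro x p hp
    rw [div_le_iff₀ (by linarith only [hp])]
    nlinarith only [abs_nonneg x, hp]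
  rw [Real.log_one, sub_zero, div_one] at L₁ L₃ M₁ M₂
  replace L₂ := L₂.trans (hdiv P₁)
  replace L₄ := L₄.trans (hdiv P₂)
  have v₁ : 0 < ε ^ 2 * q₁ := by positivity
  have v₂ : 0 < ε ^ 2 * q₂ := by positivity
  have v₃ : 0 < ε ^ 2 * q₃ := by positivity
  have v₄ : 0 < ε ^ 2 * q₄ := by positivity
  refine ⟨⟨?_, ?_, ?_, ?_⟩, ⟨?_, ?_, ?_, ?_⟩, ?_⟩
  · linarith only [P₂, (abs_le.1 hx₄).1, w₄, hε2]
  · linarith only [(abs_le.1 hx₁).1, w₁, hε2]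
  · linarith only [P₁, (abs_le.1 hx₂).1, w₂, hε2]
  · linarith only [(abs_le.1 hx₃).1, w₃, hε2]
  · rw [abs_mul, abs_two]
    linarith only [abs_sub_abs_le_abs_sub (Real.log (1 + y₂ + x₄)) (Real.log (1 + y₂)),
      L₄, M₂, hx₄, hy₂, w₄, hε0]
  · rw [abs_mul, abs_two]
    linarith only [L₁, hx₁, w₁, hε0]
  · rw [abs_mul, abs_two]
    linarith only [abs_sub_abs_le_abs_sub (Real.log (1 + y₁ + x₂)) (Real.log (1 + y₁)),
      L₂, M₁, hx₂, hy₁, w₂, hε0]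
  · rw [abs_mul, abs_two]
    linarith only [L₃, hx₃, w₃, hε0]
  · rw [Real.log_mul (by linarith only [P₁]) (by linarith only [P₂])]
    rw [abs_le] at L₁ L₂ L₃ L₄
    rw [abs_lt]
    constructor
    · linarith only [L₁.1, L₂.1, L₃.1, L₄.1, hx₁, hx₂, hx₃, hx₄, v₁, v₂, v₃, v₄]
    · linarith only [L₁.2, L₂.2, L₃.2, L₄.2, hx₁, hx₂, hx₃, hx₄, v₁, v₂, v₃, v₄]

/-- The product of the four flow segments and the four encounter jumps has an axis that passes
close to the four reference points. At each reference point the axis is given by its coordinates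
in the Poincaré section there; `l₁, …, l₄` are the time shifts that it picks up in the jumps. -/
lemma exists_closing_frames {ε u₁ s₁ u₂ s₂ T₁ T₂ T₃ T₄ : ℝ} (hε : 0 < ε) (hε2 : ε ^ 2 ≤ 1 / 30)
    (hu₁ : |u₁| ≤ ε) (hs₁ : |s₁| ≤ ε) (hu₂ : |u₂| ≤ ε) (hs₂ : |s₂| ≤ ε)
    (hT₁ : Real.exp (-T₁) ≤ 1 / 13) (hT₂ : Real.exp (-T₂) ≤ 1 / 6)
    (hT₃ : Real.exp (-T₃) ≤ 1 / 3) (hT₄ : Real.exp (-T₄) ≤ 1)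
    (hs : 3 * ε * Real.exp (-T₃) < |s₁|) :
    ∃ my sy mz sz mw sw mx sx l₁ l₂ l₃ l₄ : ℝ,
      (|my| ≤ 2 * ε * Real.exp (-T₂) ∧ |sy| ≤ 4 * ε ∧ sy ≠ 0) ∧
      (|mz| ≤ 2 * ε ∧ |sz| ≤ 5 * ε * Real.exp (-T₃)) ∧
      (|mw| ≤ 2 * ε * Real.exp (-T₄) ∧ |sw| ≤ 3 * ε) ∧
      (|mx| ≤ 3 * ε ∧ |sx| ≤ 3 * ε * Real.exp (-T₁)) ∧
      (|l₁| ≤ 11 * ε ^ 2 ∧ |l₂| ≤ ε ^ 2 ∧ |l₃| ≤ 6 * ε ^ 2 ∧ |l₄| ≤ 3 * ε ^ 2) ∧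
      |(l₁ + l₂ + l₃ + l₄) / 2 - Real.log ((1 + u₁ * s₁) * (1 + u₂ * s₂))| <
        ε ^ 2 * (21 * Real.exp (-T₁) + 30 * Real.exp (-T₂) + 12 * Real.exp (-T₃)
          + 19 * Real.exp (-T₄)) ∧
      b (-s₁) * c (-u₁) * (c my * b sy) = c mz * b sz * a l₃ ∧
      a T₄ * (c u₂ * b s₂) * a T₃ * (c mz * b sz) = c mw * b sw * a (T₄ + l₄ + T₃) ∧
      b (-u₂) * c (-s₂) * (c mw * b sw) = c mx * b sx * a l₁ ∧
      a T₂ * (c s₁ * b u₁) * a T₁ * (c mx * b sx) = c my * b sy * a (T₂ + l₂ + T₁) := by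
  have q₁0 := Real.exp_pos (-T₁)
  have q₂0 := Real.exp_pos (-T₂)
  have q₃0 := Real.exp_pos (-T₃)
  have q₄0 := Real.exp_pos (-T₄)
  have hp : ∀ {u s : ℝ}, |u| ≤ ε → |s| ≤ ε → |1 + u * s - 1| ≤ ε ^ 2 := fun {u s} hu hs => by
    rw [add_sub_cancel_left, abs_mul, sq]
    gcongr
  have hp₁ := hp hu₁ hs₁
  have hp₂ := hp hu₂ hs₂
  have nu₁ : |-u₁| ≤ ε := by rwa [abs_neg]
  have ns₁ : |-s₁| ≤ ε := by rwa [abs_neg]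
  have nu₂ : |-u₂| ≤ ε := by rwa [abs_neg]
  have ns₂ : |-s₂| ≤ ε := by rwa [abs_neg]
  -- the slopes of the expanding direction along the closed chain
  obtain ⟨μ₃, μ₄, μ₁, μ₂, bμ₃, bμ₄, bμ₁, bμ₂, E₃, E₄, E₁, E₂⟩ :=
    exists_mobius_cycle (R₁ := 8 / 5) (R₂ := 8 / 5) (R₃ := 3) (R₄ := 13 / 10)
      (ρ₁ := 27 / 50) (ρ₂ := 8 / 5) (ρ₃ := 6 / 25) (ρ₄ := 1 / 2) hε hε2 hp₁ hp₂ hp₂ hp₁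
      nu₁ hu₂ ns₂ hs₁ ns₁ hs₂ nu₂ hu₁ q₃0 q₄0 q₁0 q₂0
      (by linarith) (by linarith) (by linarith) (by linarith) (by norm_num) (by norm_num)
      (by norm_num) (by norm_num) (by norm_num) (by norm_num) (by norm_num) (by norm_num)
      (by norm_num)
  -- the inverse slopes of the contracting direction, found by running the chain backwards
  obtain ⟨n₄, n₃, n₂, n₁, bn₄, bn₃, bn₂, bn₁, N₄, N₃, N₂, N₁⟩ :=
    exists_mobius_cycle (R₁ := 6 / 5) (R₂ := 12 / 5) (R₃ := 2) (R₄ := 7 / 5)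
      (ρ₁ := 6 / 5) (ρ₂ := 4 / 5) (ρ₃ := 1 / 3) (ρ₄ := 11 / 100) hε hε2 hp₂ hp₂ hp₁ hp₁
      hu₂ ns₂ hs₁ nu₁ hs₂ nu₂ hu₁ ns₁ q₄0 q₃0 q₂0 q₁0
      (by linarith) (by linarith) (by linarith) (by linarith) (by norm_num) (by norm_num)
      (by norm_num) (by norm_num) (by norm_num) (by norm_num) (by norm_num) (by norm_num)
      (by norm_num)
  set q₁ := Real.exp (-T₁) with hq₁
  set q₂ := Real.exp (-T₂) with hq₂
  set q₃ := Real.exp (-T₃) with hq₃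
  set q₄ := Real.exp (-T₄) with hq₄
  have hprod : ∀ {q μ n : ℝ}, 0 < q → q ≤ 1 → |μ| ≤ 3 * ε → |n| ≤ 12 / 5 * ε →
      |q * μ * n| ≤ 1 / 2 := by
    intro q μ n h0 h1 hμ hn
    rw [abs_mul, abs_mul, abs_of_pos h0]
    calc q * |μ| * |n| ≤ 1 * (3 * ε) * (12 / 5 * ε) := by gcongr
      _ = 36 / 5 * ε ^ 2 := by ring
      _ ≤ 1 / 2 := by linarith
  have k₁ : |q₁ * μ₁ * n₁| ≤ 1 / 2 := hprod q₁0 (by linarith) (by linarith) (by linarith)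
  have k₂ : |q₂ * μ₂ * n₂| ≤ 1 / 2 := hprod q₂0 (by linarith) (by linarith) (by linarith)
  have k₃ : |q₃ * μ₃ * n₃| ≤ 1 / 2 := hprod q₃0 (by linarith) (by linarith) (by linarith)
  have k₄ : |q₄ * μ₄ * n₄| ≤ 1 / 2 := hprod q₄0 (by linarith) (by linarith) (by linarith)
  have k₁' : |μ₁ * (q₁ * n₁)| ≤ 1 / 2 := by rwa [← mul_assoc, mul_comm μ₁]
  have k₂' : |μ₂ * (q₂ * n₂)| ≤ 1 / 2 := by rwa [← mul_assoc, mul_comm μ₂]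
  have k₃' : |μ₃ * (q₃ * n₃)| ≤ 1 / 2 := by rwa [← mul_assoc, mul_comm μ₃]
  have k₄' : |μ₄ * (q₄ * n₄)| ≤ 1 / 2 := by rwa [← mul_assoc, mul_comm μ₄]
  have hne : ∀ {m n : ℝ}, |m * n| ≤ 1 / 2 → 1 - m * n ≠ 0 := fun {m n} h h0 => by
    linarith [(abs_le.1 h).2]
  have hqm : ∀ {q x R : ℝ}, 0 < q → |x| ≤ R * ε → |q * x| ≤ R * ε * q := by
    intro q x R h0 hx
    rw [abs_mul, abs_of_pos h0, mul_comm]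
    gcongr
  -- the perturbations inside the logarithms
  have hx : ∀ {t q μ R : ℝ}, |t| ≤ ε → 0 < q → |μ| ≤ R * ε → |t * (q * μ)| ≤ R * ε ^ 2 * q := by
    intro t q μ R ht h0 hμ
    have hR : 0 ≤ R * ε := (abs_nonneg _).trans hμ
    rw [abs_mul]
    calc |t| * |q * μ| ≤ ε * (R * ε * q) := by
          gcongr
          exact hqm h0 hμ
      _ = _ := by ring
  have hx₁ : |u₁ * (q₁ * μ₁)| ≤ 3 * ε ^ 2 * q₁ := hx hu₁ q₁0 bμ₁
  have hx₂ : |-s₁ * (q₂ * μ₂)| ≤ 13 / 10 * ε ^ 2 * q₂ := hx ns₁ q₂0 bμ₂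
  have hx₃ : |s₂ * (q₃ * μ₃)| ≤ 8 / 5 * ε ^ 2 * q₃ := hx hs₂ q₃0 bμ₃
  have hx₄ : |-u₂ * (q₄ * μ₄)| ≤ 8 / 5 * ε ^ 2 * q₄ := hx nu₂ q₄0 bμ₄
  rw [add_sub_cancel_left] at hp₁ hp₂
  obtain ⟨⟨pos₄, pos₁, pos₂, pos₃⟩, hl, hact⟩ := shift_estimates hε hε2 q₁0 q₂0 q₃0 q₄0
    hT₁ hT₂ hT₃ hT₄ hp₁ hp₂ hx₁ hx₂ hx₃ hx₄
  have c₁ : -s₁ * -u₁ = u₁ * s₁ := by ring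
  have J₃ := b_mul_c_mul_frame (s := -s₁) (u := -u₁) (m := q₂ * μ₂) (n := n₂) (m' := μ₃)
    (n' := q₃ * n₃) (by rwa [c₁]) (by rw [c₁, E₃]) (by linarith only [N₂])
    (hne k₂) (hne k₃')
  have J₄ := c_mul_b_mul_frame (s := s₂) (u := u₂) (m := q₃ * μ₃) (n := n₃) (m' := μ₄)
    (n' := q₄ * n₄) pos₃ E₄ (by linarith only [N₃]) (hne k₃) (hne k₄')
  have J₁ := b_mul_c_mul_frame (s := -u₂) (u := -s₂) (m := q₄ * μ₄) (n := n₄) (m' := μ₁)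
    (n' := q₁ * n₁) (by rwa [neg_mul_neg]) (by rw [neg_mul_neg, E₁]) (by linarith only [N₄])
    (hne k₄) (hne k₁')
  have J₂ := c_mul_b_mul_frame (s := u₁) (u := s₁) (m := q₁ * μ₁) (n := n₁) (m' := μ₂)
    (n' := q₂ * n₂) pos₁ (by linarith only [E₂]) (by linarith only [N₁]) (hne k₁) (hne k₂')
  have A₁ := a_mul_frame T₁ μ₁ n₁
  have A₂ := a_mul_frame T₂ μ₂ n₂
  have A₃ := a_mul_frame T₃ μ₃ n₃
  have A₄ := a_mul_frame T₄ μ₄ n₄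
  rw [← hq₁] at A₁
  rw [← hq₂] at A₂
  rw [← hq₃] at A₃
  rw [← hq₄] at A₄
  rw [c₁] at J₃
  rw [neg_mul_neg] at J₁
  have hn₂ : n₂ ≠ 0 := by
    rintro rfl
    have : s₁ = -(q₃ * n₃) := by linarith
    rw [this, abs_neg] at hs
    have := hqm q₃0 bn₃
    have : 0 < ε * q₃ := by positivity
    linarith
  have t₂ := hqm q₂0 bμ₂
  have t₄ := hqm q₄0 bμ₄
  have t₃ := hqm q₃0 bn₃
  have t₁ := hqm q₁0 bn₁
  have z₁ : 0 < ε * q₁ := by positivity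
  have z₂ : 0 < ε * q₂ := by positivity
  have z₃ : 0 < ε * q₃ := by positivity
  have z₄ : 0 < ε * q₄ := by positivity
  refine ⟨q₂ * μ₂, n₂ / (1 - q₂ * μ₂ * n₂), μ₃, q₃ * n₃ / (1 - μ₃ * (q₃ * n₃)), q₄ * μ₄,
    n₄ / (1 - q₄ * μ₄ * n₄), μ₁, q₁ * n₁ / (1 - μ₁ * (q₁ * n₁)),
    2 * Real.log (1 + u₂ * s₂ + -u₂ * (q₄ * μ₄)), 2 * Real.log (1 + u₁ * (q₁ * μ₁)),
    2 * Real.log (1 + u₁ * s₁ + -s₁ * (q₂ * μ₂)), 2 * Real.log (1 + s₂ * (q₃ * μ₃)),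
    ⟨?_, ?_, div_ne_zero hn₂ (hne k₂)⟩, ⟨?_, ?_⟩, ⟨?_, ?_⟩, ⟨bμ₁, ?_⟩, hl, hact, J₃, ?_, J₁, ?_⟩
  · linarith only [t₂, z₂]
  · linarith only [abs_frame_coord_le k₂, bn₂]
  · linarith only [bμ₃, hε]
  · linarith only [abs_frame_coord_le k₃', t₃, z₃]
  · linarith only [t₄, z₄]
  · linarith only [abs_frame_coord_le k₄, bn₄, hε]
  · linarith only [abs_frame_coord_le k₁', t₁, z₁]
  · rw [a_add, a_add]
    exact chain_eq A₃ J₄ A₄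
  · rw [a_add, a_add]
    exact chain_eq A₁ J₂ A₂

/-! ### Shadowing along the closed chain -/

lemma c_mul_a (m t : ℝ) : c m * a t = a t * c (m * Real.exp t) := by
  have h : Real.exp t = Real.exp (t / 2) * Real.exp (t / 2) := by
    rw [← Real.exp_add]; ring_nf
  have e' : Real.exp (t / 2) * Real.exp (-(t / 2)) = 1 := by rw [← Real.exp_add]; simp
  rw [c, a, c, ← cls_mul, ← cls_mul, h]
  congr 1
  refine sl_ext ?_ ?_ ?_ ?_ <;>
    simp only [mul_entry, coe_matA, coe_matC, Matrix.of_apply, Matrix.cons_val',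
      Matrix.cons_val_zero, Matrix.cons_val_one, Matrix.cons_val_fin_one]
  · ring
  · ring
  · linear_combination -m * Real.exp (t / 2) * e'
  · ring

lemma b_mul_a (s t : ℝ) : b s * a t = a t * b (s * Real.exp (-t)) := by
  have h : Real.exp (-t) = Real.exp (-(t / 2)) * Real.exp (-(t / 2)) := by
    rw [← Real.exp_add]; ring_nf
  have e' : Real.exp (t / 2) * Real.exp (-(t / 2)) = 1 := by rw [← Real.exp_add]; simp
  rw [b, a, b, ← cls_mul, ← cls_mul, h]
  congr 1
  refine sl_ext ?_ ?_ ?_ ?_ <;>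
    simp only [mul_entry, coe_matA, coe_matB, Matrix.of_apply, Matrix.cons_val',
      Matrix.cons_val_zero, Matrix.cons_val_one, Matrix.cons_val_fin_one]
  · ring
  · linear_combination -s * Real.exp (-(t / 2)) * e'
  · ring
  · ring

lemma dG_one_c_mul_b_le (u s : ℝ) : dG 1 (c u * b s) ≤ |u| + |s| :=
  (dG_one_mul_le _ _).trans (add_le_add (dG_one_c_le u) (dG_one_b_le s))

lemma dG_mul_section_mul_a_le (p : G) (m s t : ℝ) :
    dG (p * a t) (p * (c m * b s) * a t) ≤ |m| * Real.exp t + |s| * Real.exp (-t) := by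
  have h : p * (c m * b s) * a t =
      p * a t * (c (m * Real.exp t) * b (s * Real.exp (-t))) := by
    rw [mul_assoc, mul_assoc (c m), b_mul_a, ← mul_assoc (c m), c_mul_a]
    simp only [mul_assoc]
  rw [h, dG_mul_self_left]
  refine (dG_one_c_mul_b_le _ _).trans (le_of_eq ?_)
  rw [abs_mul, abs_mul, abs_of_pos (Real.exp_pos t), abs_of_pos (Real.exp_pos (-t))]

lemma followsFor_section (Γ : Subgroup G) {p : G} {m s M S δ l : ℝ}
    (hm : |m| ≤ M * Real.exp (-l)) (hs : |s| ≤ S) (hδ : M + S < δ) :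
    FollowsFor Γ δ l (proj Γ p) (proj Γ (p * (c m * b s))) := by
  intro t ht
  rw [flow_proj, flow_proj]
  refine ((dX_proj_le Γ _ _).trans (dG_mul_section_mul_a_le p m s t)).trans_lt ?_
  have h1 : |m| * Real.exp t ≤ M := by
    calc |m| * Real.exp t ≤ M * Real.exp (-l) * Real.exp l := by
          gcongr
          · exact (abs_nonneg _).trans hm
          · exact ht.2
      _ = M := by rw [mul_assoc, ← Real.exp_add]; simp
  have h2 : |s| * Real.exp (-t) ≤ S * 1 := by
    gcongr
    · exact (abs_nonneg _).trans hs
    · exact Real.exp_le_one_iff.2 (by linarith [ht.1])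
  linarith

lemma followsFor_section_rev (Γ : Subgroup G) {p : G} {m s M S δ l τ : ℝ}
    (hm : |m| ≤ M) (hs : |s| ≤ S * Real.exp (-l)) (hδ : M + S + |τ| < δ) :
    FollowsFor Γ δ l (proj Γ (p * dPi)) (proj Γ (p * (c m * b s) * a τ * dPi)) := by
  intro t ht
  rw [flow_proj, flow_proj]
  refine (dX_proj_le Γ _ _).trans_lt ?_
  have e1 : p * dPi * a t = p * a (-t) * dPi := by rw [mul_assoc, dPi_mul_a, mul_assoc]
  have e2 : p * (c m * b s) * a τ * dPi * a t = p * (c m * b s) * a (-t) * a τ * dPi := by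
    rw [mul_assoc _ dPi, dPi_mul_a, ← mul_assoc, mul_assoc _ (a τ), ← a_add, mul_assoc _ (a (-t)),
      ← a_add, add_comm]
  rw [e1, e2, dG_mul_dPi]
  have k1 := dG_mul_section_mul_a_le p m s (-t)
  have k2 : dG (p * (c m * b s) * a (-t)) (p * (c m * b s) * a (-t) * a τ) ≤ |τ| := by
    rw [dG_mul_self_left]
    exact dG_one_a_le τ
  have h1 : |m| * Real.exp (-t) ≤ M * 1 := by
    gcongr
    · exact (abs_nonneg _).trans hm
    · exact Real.exp_le_one_iff.2 (by linarith [ht.1])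
  have h2 : |s| * Real.exp (- -t) ≤ S := by
    rw [neg_neg]
    calc |s| * Real.exp t ≤ S * Real.exp (-l) * Real.exp l := by
          gcongr
          · exact (abs_nonneg _).trans hs
          · exact ht.2
      _ = S := by rw [mul_assoc, ← Real.exp_add]; simp
  linarith [dG_triangle (p * a (-t)) (p * (c m * b s) * a (-t)) (p * (c m * b s) * a (-t) * a τ)]

lemma b_neg (s : ℝ) : b (-s) = (b s)⁻¹ := by
  refine eq_inv_of_mul_eq_one_left ?_
  rw [b, b, ← cls_mul, ← cls_one]
  congr 1
  refine sl_ext ?_ ?_ ?_ ?_ <;> simp [mul_entry, coe_matB]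

lemma c_neg (u : ℝ) : c (-u) = (c u)⁻¹ := by
  refine eq_inv_of_mul_eq_one_left ?_
  rw [c, c, ← cls_mul, ← cls_one]
  congr 1
  refine sl_ext ?_ ?_ ?_ ?_ <;> simp [mul_entry, coe_matC]

lemma b_zero : b 0 = 1 := by
  rw [b, ← cls_one]
  congr 1
  refine sl_ext ?_ ?_ ?_ ?_ <;> simp [coe_matB]

lemma c_zero : c 0 = 1 := by
  rw [c, ← cls_one]
  congr 1
  refine sl_ext ?_ ?_ ?_ ?_ <;> simp [coe_matC]

lemma dPi_mul_c (u : ℝ) : dPi * c u = b (-u) * dPi := by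
  rw [dPi, c, b, ← cls_mul, ← cls_mul]
  congr 1
  refine sl_ext ?_ ?_ ?_ ?_ <;> simp [mul_entry, coe_matB, coe_matC, coe_matD]

lemma dPi_mul_b (s : ℝ) : dPi * b s = c (-s) * dPi := by
  rw [dPi, c, b, ← cls_mul, ← cls_mul]
  congr 1
  refine sl_ext ?_ ?_ ?_ ?_ <;> simp [mul_entry, coe_matB, coe_matC, coe_matD]

lemma section_ext {u s u' s' : ℝ} (h : c u * b s = c u' * b s') : u = u' ∧ s = s' := by
  rcases cls_eq_cls_iff.1 (show cls (matC u * matB s) = cls (matC u' * matB s') from h) with h | h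
  · have h10 : (matC u * matB s).1 1 0 = (matC u' * matB s').1 1 0 := by rw [h]
    have h01 : (matC u * matB s).1 0 1 = (matC u' * matB s').1 0 1 := by rw [h]
    simp [mul_entry, coe_matB, coe_matC] at h10 h01
    exact ⟨h10, h01⟩
  · have h00 : (matC u * matB s).1 0 0 = (-(matC u' * matB s')).1 0 0 := by rw [h]
    rw [Matrix.SpecialLinearGroup.coe_neg, Matrix.neg_apply] at h00
    simp only [mul_entry, coe_matB, coe_matC, Matrix.of_apply, Matrix.cons_val',
      Matrix.cons_val_zero, Matrix.cons_val_one, Matrix.cons_val_fin_one] at h00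
    norm_num at h00

/-- Reconnecting in both encounters produces an orbit pair: the four stretches are run in the
order `1 → 1`, `2 → 4` (reversed), `3 → 3`, `4 → 2` (reversed). -/
lemma DiffersInBoth.isOrbitPair {Γ : Subgroup G} {δ : ℝ} {x y z w : X Γ} {T₁ T₂ T₃ T₄ T T' : ℝ}
    {O O' : Set (X Γ)} (hO : IsPeriodicOrbit Γ T O) (hO' : IsPeriodicOrbit Γ T' O')
    (hT₁ : 0 < T₁) (hT₂ : 0 < T₂) (hT₃ : 0 < T₃) (hT₄ : 0 < T₄) (hT : T₁ + T₂ + T₃ + T₄ = T)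
    (hy : y ∈ O) (hyz : flow Γ T₂ y = z) (hzw : flow Γ T₃ z = w) (hwx : flow Γ T₄ w = x)
    (H : DiffersInBoth Γ δ x y z w T₁ T₂ T₃ T₄ T' O') : IsOrbitPair Γ δ T O T' O' := by
  obtain ⟨v, hv, r₁, r₂, r₃, r₄, hr₁, hr₂, hr₃, hr₄, hr, -, -, -, -, F₂, F₁, F₄, F₃⟩ := H
  refine ⟨hO, hO', 4, by norm_num,
    ![0, T₂, T₂ + T₃, T₂ + T₃ + T₄, T], ![0, r₂, r₂ + r₁, r₂ + r₁ + r₄, T'], ?_, rfl, rfl, ?_,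
    rfl, rfl, Equiv.swap 1 3, y, hy, v, hv, ?_⟩
  · rw [Fin.strictMono_iff_lt_succ]
    intro i
    fin_cases i <;> simp <;> linarith
  · rw [Fin.strictMono_iff_lt_succ]
    intro i
    fin_cases i <;> simp <;> linarith
  · have hback : ∀ s τ : ℝ, flow Γ (τ - s) (rev Γ v) = flow Γ τ (rev Γ (flow Γ s v)) := by
      intro s τ
      rw [flow_rev, flow_rev, flow_flow]
      congr 2
      ring
    have hz : ∀ τ, flow Γ (τ + T₂) y = flow Γ τ z := fun τ => by
      rw [← hyz, flow_flow, add_comm]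
    have hw : ∀ τ, flow Γ (τ + (T₂ + T₃)) y = flow Γ τ w := fun τ => by
      rw [← hzw, ← hyz, flow_flow, flow_flow]; congr 1; ring
    have hx : ∀ τ, flow Γ (τ + (T₂ + T₃ + T₄)) y = flow Γ τ x := fun τ => by
      rw [← hwx, ← hzw, ← hyz, flow_flow, flow_flow, flow_flow]; congr 1; ring
    intro j
    fin_cases j
    · left
      intro τ hτ
      replace hτ : τ ∈ Set.Icc 0 (T₂ - 0) := hτ
      rw [sub_zero] at hτ
      have := F₂ τ hτ
      change dX Γ (flow Γ (τ + 0) y) (flow Γ (τ + 0) v) < δ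
      rwa [add_zero]
    · right
      intro τ hτ
      replace hτ : τ ∈ Set.Icc 0 (T₂ + T₃ - T₂) := hτ
      rw [add_sub_cancel_left] at hτ
      have := F₃ τ hτ
      change dX Γ (flow Γ (τ + T₂) y) (flow Γ (τ - T') (rev Γ v)) < δ
      rwa [hz, hback]
    · left
      intro τ hτ
      replace hτ : τ ∈ Set.Icc 0 (T₂ + T₃ + T₄ - (T₂ + T₃)) := hτ
      rw [add_sub_cancel_left] at hτ
      have := F₄ τ hτ
      change dX Γ (flow Γ (τ + (T₂ + T₃)) y) (flow Γ (τ + (r₂ + r₁)) v) < δ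
      rwa [hw, add_comm τ (r₂ + r₁), ← flow_flow]
    · right
      intro τ hτ
      replace hτ : τ ∈ Set.Icc 0 (T - (T₂ + T₃ + T₄)) := hτ
      rw [← hT, show T₁ + T₂ + T₃ + T₄ - (T₂ + T₃ + T₄) = T₁ by ring] at hτ
      have := F₁ τ hτ
      change dX Γ (flow Γ (τ + (T₂ + T₃ + T₄)) y) (flow Γ (τ - (r₂ + r₁)) (rev Γ v)) < δ
      rwa [hx, hback]

/-- Existence of the partner orbit, in terms of a lift `g` of `y` and the elements of `Γ` that
close up the two encounters (`A` and `B`) and the given orbit (`C`). -/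
lemma exists_partner {Γ : Subgroup G} {ε u₁ s₁ u₂ s₂ T₁ T₂ T₃ T₄ : ℝ} (hε : 0 < ε)
    (hε2 : ε ^ 2 ≤ 1 / 30)
    (hu₁ : |u₁| ≤ ε) (hs₁ : |s₁| ≤ ε) (hu₂ : |u₂| ≤ ε) (hs₂ : |s₂| ≤ ε)
    (hT₁ : Real.exp (-T₁) ≤ 1 / 13) (hT₂ : Real.exp (-T₂) ≤ 1 / 6)
    (hT₃ : Real.exp (-T₃) ≤ 1 / 3) (hT₂0 : 0 < T₂) (hT₄ : 0 < T₄)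
    (hs : 3 * ε * Real.exp (-T₃) < |s₁|)
    {g A B C : G} (hA : A ∈ Γ) (hB : B ∈ Γ) (hC : C ∈ Γ)
    (hAg : g * a T₂ * dPi = A * g * (c u₁ * b s₁))
    (hBg : g * a (-T₁) * (c u₂ * b s₂) = B * g * a (T₂ + T₃) * dPi)
    (hCg : g * a (T₁ + T₂ + T₃ + T₄) = C * g) :
    ∃ m s T' : ℝ, |m| ≤ 2 * ε * Real.exp (-T₂) ∧ |s| ≤ 4 * ε ∧ s ≠ 0 ∧
      IsPeriodicOrbit Γ T' (orbit Γ (proj Γ (g * (c m * b s)))) ∧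
      DiffersInBoth Γ (20 * ε) (proj Γ (g * a (-T₁))) (proj Γ g) (proj Γ (g * a T₂))
        (proj Γ (g * a (T₂ + T₃))) T₁ T₂ T₃ T₄ T' (orbit Γ (proj Γ (g * (c m * b s)))) ∧
      |(T' - (T₁ + T₂ + T₃ + T₄)) / 2 - Real.log ((1 + u₁ * s₁) * (1 + u₂ * s₂))| <
        ε ^ 2 * (21 * Real.exp (-T₁) + 30 * Real.exp (-T₂) + 12 * Real.exp (-T₃)
          + 19 * Real.exp (-T₄)) := by
  have hT₄' : Real.exp (-T₄) ≤ 1 := Real.exp_le_one_iff.2 (by linarith)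
  obtain ⟨my, sy, mz, sz, mw, sw, mx, sx, l₁, l₂, l₃, l₄, ⟨bmy, bsy, hsy⟩, ⟨bmz, bsz⟩, ⟨bmw, bsw⟩,
    ⟨bmx, bsx⟩, ⟨bl₁, bl₂, bl₃, bl₄⟩, hact, Hz, Hw, Hx, Hy⟩ :=
    exists_closing_frames hε hε2 hu₁ hs₁ hu₂ hs₂ hT₁ hT₂ hT₃ hT₄' hs
  have hT₁g : 12 / 13 ≤ T₁ := by linarith [Real.add_one_le_exp (-T₁)]
  have hT₃g : 2 / 3 ≤ T₃ := by linarith [Real.add_one_le_exp (-T₃)]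
  have hε5 : ε ≤ 1 / 5 := by
    by_contra! h
    nlinarith
  have hεε : ε ^ 2 ≤ ε / 5 := by nlinarith
  -- the jumps of the reversed stretches
  have eE₁ : c s₁ * b u₁ * dPi = dPi * (b (-s₁) * c (-u₁)) := by
    rw [← mul_assoc, dPi_mul_b, mul_assoc _ dPi, dPi_mul_c, neg_neg, neg_neg, mul_assoc]
  have eE₂ : dPi * (c u₂ * b s₂) * dPi = b (-u₂) * c (-s₂) := by
    rw [← mul_assoc, dPi_mul_c, mul_assoc _ dPi, dPi_mul_b, ← mul_assoc, mul_assoc _ dPi,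
      dPi_mul_dPi, mul_one]
  have einv : b (-s₁) * c (-u₁) = (c u₁ * b s₁)⁻¹ := by rw [mul_inv_rev, b_neg, c_neg]
  set P : G := g * a T₂ * (c s₁ * b u₁) * a T₁ with hP
  have hAg1 : A * g = g * a T₂ * dPi * (b (-s₁) * c (-u₁)) := by
    rw [hAg, einv, mul_inv_cancel_right]
  have hAg2 : A * (g * a (-T₁)) = P * dPi := by
    rw [← mul_assoc, hAg1, mul_assoc _ dPi, ← eE₁, hP, mul_assoc _ (a T₁), ← neg_neg T₁,
      ← dPi_mul_a, neg_neg]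
    simp only [mul_assoc]
  have hBg1 : B * (g * a (T₂ + T₃)) = g * a (-T₁) * (c u₂ * b s₂) * dPi := by
    rw [hBg, mul_assoc _ dPi, dPi_mul_dPi, mul_one, mul_assoc]
  have hABg : A * B * (g * a (T₂ + T₃)) = P * (b (-u₂) * c (-s₂)) := by
    rw [mul_assoc, hBg1, ← mul_assoc, ← mul_assoc, hAg2, ← eE₂]
    simp only [mul_assoc]
  have hCg1 : C * (g * a (-T₁)) = g * a (T₂ + T₃) * a T₄ := by
    rw [← mul_assoc, ← hCg, mul_assoc, ← a_add, mul_assoc, ← a_add]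
    congr 2
    ring
  have hBg2 : B * (g * a T₂) = g * a (-T₁) * (c u₂ * b s₂) * a T₃ * dPi := by
    have : a T₂ = a (T₂ + T₃) * a (-T₃) := by rw [← a_add]; congr 1; ring
    rw [this, ← mul_assoc g, ← mul_assoc B, hBg1, mul_assoc _ dPi, dPi_mul_a, neg_neg,
      ← mul_assoc]
  have hη : A * B * C * B * A * g =
      P * (b (-u₂) * c (-s₂)) * a T₄ * (c u₂ * b s₂) * a T₃ * (b (-s₁) * c (-u₁)) := by
    calc A * B * C * B * A * g = A * B * C * (B * (g * a T₂)) * dPi * (b (-s₁) * c (-u₁)) := by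
          rw [mul_assoc _ A, hAg1]
          simp only [mul_assoc]
      _ = A * B * (C * (g * a (-T₁))) * (c u₂ * b s₂) * a T₃ * (dPi * dPi) *
          (b (-s₁) * c (-u₁)) := by
          rw [hBg2]
          simp only [mul_assoc]
      _ = A * B * (g * a (T₂ + T₃)) * a T₄ * (c u₂ * b s₂) * a T₃ * (b (-s₁) * c (-u₁)) := by
          rw [hCg1, dPi_mul_dPi, mul_one]
          simp only [mul_assoc]
      _ = _ := by rw [hABg]
  -- the point of the axis near the reference point `w`
  set τ : ℝ := T₂ + l₂ + T₁ + l₁ with hτ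
  have hx : P * (c mx * b sx) = g * (c my * b sy) * a (T₂ + l₂ + T₁) := by
    calc _ = g * (a T₂ * (c s₁ * b u₁) * a T₁ * (c mx * b sx)) := by
          rw [hP]; simp only [mul_assoc]
      _ = _ := by rw [Hy, ← mul_assoc]
  have hxτ : g * (c my * b sy) * a τ = P * (c mx * b sx) * a l₁ := by
    rw [hx, hτ, a_add _ l₁, mul_assoc _ _ (a l₁)]
  have hwτ : g * (c my * b sy) * a τ = P * (b (-u₂) * c (-s₂)) * (c mw * b sw) := by
    rw [hxτ, mul_assoc, ← Hx, ← mul_assoc]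
  have hz : g * (c my * b sy) = g * (c u₁ * b s₁) * (c mz * b sz) * a l₃ := by
    have : c my * b sy = (c u₁ * b s₁) * (c mz * b sz * a l₃) := by
      rw [← Hz, einv, mul_inv_cancel_left]
    rw [this]
    simp only [mul_assoc]
  set T' : ℝ := τ + (T₄ + l₄ + T₃) + l₃ with hT'
  have hper : A * B * C * B * A * (g * (c my * b sy)) = g * (c my * b sy) * a T' := by
    calc _ = A * B * C * B * A * g * (c my * b sy) := by rw [← mul_assoc]
      _ = P * (b (-u₂) * c (-s₂)) * a T₄ * (c u₂ * b s₂) * a T₃ *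
          (b (-s₁) * c (-u₁) * (c my * b sy)) := by rw [hη]; simp only [mul_assoc]
      _ = P * (b (-u₂) * c (-s₂)) * (a T₄ * (c u₂ * b s₂) * a T₃ * (c mz * b sz)) * a l₃ := by
          rw [Hz]; simp only [mul_assoc]
      _ = P * (b (-u₂) * c (-s₂)) * (c mw * b sw) * a (T₄ + l₄ + T₃) * a l₃ := by
          rw [Hw]; simp only [mul_assoc]
      _ = _ := by
          rw [← hwτ, hT', a_add _ l₃, a_add τ]
          simp only [mul_assoc]
  have hflow : flow Γ T' (proj Γ (g * (c my * b sy))) = proj Γ (g * (c my * b sy)) := by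
    rw [flow_proj, ← hper, proj_mul_left]
    exact Γ.mul_mem (Γ.mul_mem (Γ.mul_mem (Γ.mul_mem hA hB) hC) hB) hA
  rw [abs_le] at bl₁ bl₂ bl₃ bl₄
  have hr₁ : |l₁ + l₂| ≤ 12 * ε ^ 2 := abs_le.2 ⟨by linarith, by linarith⟩
  have hr₃ : |l₃ + l₄| ≤ 9 * ε ^ 2 := abs_le.2 ⟨by linarith, by linarith⟩
  have p₁ : 0 < T₁ + l₁ + l₂ := by linarith
  have p₃ : 0 < T₃ + l₃ + l₄ := by linarith
  refine ⟨my, sy, T', bmy, bsy, hsy, ⟨by rw [hT', hτ]; linarith, _, hflow, rfl⟩, ?_, ?_⟩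
  · refine ⟨_, ⟨0, flow_zero Γ _⟩, T₁ + l₁ + l₂, T₂, T₃ + l₃ + l₄, T₄, p₁, hT₂0, p₃, hT₄,
      by rw [hT', hτ]; ring, ?_, by simpa using hε, ?_, by simpa using hε, ?_, ?_, ?_, ?_⟩
    · rw [show T₁ + l₁ + l₂ - T₁ = l₁ + l₂ by ring]
      linarith
    · rw [show T₃ + l₃ + l₄ - T₃ = l₃ + l₄ by ring]
      linarith
    · exact followsFor_section Γ bmy bsy (by linarith)
    · have hpx : proj Γ (g * a (-T₁)) = proj Γ (P * dPi) := by
        rw [← hAg2, proj_mul_left hA]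
      rw [show T₂ + (T₁ + l₁ + l₂) = τ by rw [hτ]; ring, hpx, flow_proj, rev_proj, hxτ]
      refine followsFor_section_rev Γ bmx bsx ?_
      have : |l₁| ≤ 11 * ε ^ 2 := abs_le.2 bl₁
      linarith
    · have hpw : proj Γ (g * a (T₂ + T₃)) = proj Γ (P * (b (-u₂) * c (-s₂))) := by
        rw [← hABg, proj_mul_left (Γ.mul_mem hA hB)]
      rw [show T₂ + (T₁ + l₁ + l₂) = τ by rw [hτ]; ring, hpw, flow_proj, hwτ]
      exact followsFor_section Γ bmw bsw (by linarith)
    · have hpz : proj Γ (g * a T₂) = proj Γ (g * (c u₁ * b s₁) * dPi) := by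
        have : A * (g * (c u₁ * b s₁) * dPi) = g * a T₂ := by
          rw [← mul_assoc, ← mul_assoc, ← hAg, mul_assoc _ dPi, dPi_mul_dPi, mul_one]
        rw [← this, proj_mul_left hA]
      rw [hflow, hpz, rev_proj, hz]
      refine followsFor_section_rev Γ bmz bsz ?_
      have : |l₃| ≤ 6 * ε ^ 2 := abs_le.2 bl₃
      linarith
  · rwa [show T' - (T₁ + T₂ + T₃ + T₄) = l₁ + l₂ + l₃ + l₄ by rw [hT', hτ]; ring]

end HadamardGutzwiller

end

theorem mainTheorem1 (Γ : Subgroup HadamardGutzwiller.G) (hdisc : DiscreteTopology Γ)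
    (hcomp : CompactSpace (HadamardGutzwiller.X Γ)) :
    ∃ εs : ℝ, HadamardGutzwiller.IsExpansivityConst Γ εs ∧
      ∀ σ₀ : ℝ, HadamardGutzwiller.IsSeparationConst Γ σ₀ →
      ∀ ε : ℝ, 0 < ε → ε < σ₀ / 24 →
      ∀ (T : ℝ) (O : Set (HadamardGutzwiller.X Γ)), HadamardGutzwiller.IsPeriodicOrbit Γ T O →
      ∀ x ∈ O, ∀ y ∈ O, ∀ z ∈ O, ∀ w ∈ O,
      ∀ T₁ T₂ T₃ T₄ : ℝ, 0 < T₁ → 0 < T₂ → 0 < T₃ → 0 < T₄ → T₁ + T₂ + T₃ + T₄ = T →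
      HadamardGutzwiller.flow Γ T₁ x = y → HadamardGutzwiller.flow Γ T₂ y = z →
      HadamardGutzwiller.flow Γ T₃ z = w → HadamardGutzwiller.flow Γ T₄ w = x →
      ∀ u₁ s₁ u₂ s₂ : ℝ,
      HadamardGutzwiller.HasCoords Γ ε y (HadamardGutzwiller.rev Γ z) u₁ s₁ →
      HadamardGutzwiller.HasCoords Γ ε x (HadamardGutzwiller.rev Γ w) u₂ s₂ →
      |u₁| > 6 * ε * Real.exp (-T₂) →
      |s₁| > 30 * ε ^ 3 + 13 * ε * Real.exp (-T₁) + 5 * ε * Real.exp (-T₂)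
        + 3 * ε * Real.exp (-T₃) →
      ∃ (T' : ℝ) (O' : Set (HadamardGutzwiller.X Γ)),
        HadamardGutzwiller.IsOrbitPair Γ (20 * ε) T O T' O' ∧
        HadamardGutzwiller.DiffersInBoth Γ (20 * ε) x y z w T₁ T₂ T₃ T₄ T' O' ∧
        (∃ v ∈ O', (∃ u s : ℝ, HadamardGutzwiller.HasCoords Γ (6 * ε) y v u s) ∧
          v ≠ y ∧ v ≠ HadamardGutzwiller.rev Γ z) ∧
        |(T' - T) / 2 - Real.log ((1 + u₁ * s₁) * (1 + u₂ * s₂))| <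
          ε ^ 2 * (21 * Real.exp (-T₁) + 30 * Real.exp (-T₂) + 12 * Real.exp (-T₃)
            + 19 * Real.exp (-T₄)) ∧
        (ε < εs / 40 → ∀ (T'' : ℝ) (O'' : Set (HadamardGutzwiller.X Γ)),
          HadamardGutzwiller.IsPeriodicOrbit Γ T'' O'' →
          HadamardGutzwiller.DiffersInBoth Γ (20 * ε) x y z w T₁ T₂ T₃ T₄ T'' O'' →
          O'' = O' ∧ T'' = T') := by
  open HadamardGutzwiller in
  obtain ⟨σ, hσ⟩ := exists_isSeparationConst Γ hdisc hcomp
  have hσ0 := hσ.1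
  refine ⟨σ / 4, hσ.isExpansivityConst (by linarith) (by linarith), ?_⟩
  intro σ₀ hσ₀ ε hε hεσ T O hO x hx y hy z hz w hw T₁ T₂ T₃ T₄ hT₁ hT₂ hT₃ hT₄ hT hxy hyz hzw hwx
    u₁ s₁ u₂ s₂ hcy hcx hu₁ hs₁
  obtain ⟨bu₁, bs₁, g, hgy, hzg⟩ := hcy
  obtain ⟨bu₂, bs₂, g', hgx, hwg⟩ := hcx
  -- the lower bounds on `u₁` and `s₁` force `ε` to be small and the stretches to be long
  have q₁0 := Real.exp_pos (-T₁)
  have q₂0 := Real.exp_pos (-T₂)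
  have q₃0 := Real.exp_pos (-T₃)
  have hsmall : ε * (30 * ε ^ 2 + 13 * Real.exp (-T₁) + 5 * Real.exp (-T₂) + 3 * Real.exp (-T₃)) <
      ε * 1 := by nlinarith
  have hsmall' := lt_of_mul_lt_mul_left hsmall hε.le
  have hsmall2 : ε * (6 * Real.exp (-T₂)) < ε * 1 := by nlinarith
  have hsmall2' := lt_of_mul_lt_mul_left hsmall2 hε.le
  have hε2 : 0 < ε ^ 2 := by positivity
  -- lifts of the four points to one flow line, and the deck transformations
  have hxg : x = proj Γ (g * a (-T₁)) := by
    rw [← flow_proj, hgy, ← hxy, flow_flow, add_neg_cancel, flow_zero]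
  have hzg' : z = proj Γ (g * a T₂) := by rw [← hyz, ← hgy, flow_proj]
  have hwg' : w = proj Γ (g * a (T₂ + T₃)) := by
    rw [← hzw, ← hyz, flow_flow, ← hgy, flow_proj]
  obtain ⟨A, hA, hAg⟩ : ∃ A ∈ Γ, g * a T₂ * dPi = A * g * (c u₁ * b s₁) := by
    rw [hzg', rev_proj] at hzg
    obtain ⟨A, hA, h⟩ := proj_eq_proj_iff.1 hzg.symm
    exact ⟨A, hA, by rw [h]; simp only [mul_assoc]⟩
  obtain ⟨B, hB, hBg⟩ : ∃ B ∈ Γ,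
      g * a (-T₁) * (c u₂ * b s₂) = B * g * a (T₂ + T₃) * dPi := by
    rw [hxg] at hgx
    obtain ⟨B₁, hB₁, h₁⟩ := proj_eq_proj_iff.1 hgx
    rw [hwg', rev_proj] at hwg
    obtain ⟨B₂, hB₂, h₂⟩ := proj_eq_proj_iff.1 hwg
    refine ⟨B₁ * B₂, Γ.mul_mem hB₁ hB₂, ?_⟩
    rw [h₁]
    simp only [mul_assoc] at h₂ ⊢
    rw [h₂]
  obtain ⟨C, hC, hCg⟩ : ∃ C ∈ Γ, g * a (T₁ + T₂ + T₃ + T₄) = C * g := by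
    refine exists_mul_a_eq_of_flow_eq ?_
    obtain ⟨-, o, ho, rfl⟩ := hO
    rw [hT, hgy]
    exact flow_eq_self_of_mem_orbit ho hy
  have bs₁' : 3 * ε * Real.exp (-T₃) < |s₁| := by
    have h1 : 0 < ε ^ 3 := by positivity
    have h2 : 0 < ε * Real.exp (-T₁) := by positivity
    have h3 : 0 < ε * Real.exp (-T₂) := by positivity
    linarith
  obtain ⟨m, s, T', hm, hs, hs0, hper, hdiff, hact⟩ := exists_partner hε (by linarith) bu₁.le
    bs₁.le bu₂.le bs₂.le (by linarith) (by linarith) (by linarith) hT₂ hT₄ bs₁' hA hB hC hAg hBg hCg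
  have hm' : |m| ≤ ε := by
    have : ε * Real.exp (-T₂) ≤ ε * (1 / 6) := by gcongr; linarith
    linarith
  rw [← hxg, hgy, ← hzg', ← hwg'] at hdiff
  rw [hT] at hact
  refine ⟨T', _, hdiff.isOrbitPair hO hper hT₁ hT₂ hT₃ hT₄ hT hy hyz hzw hwx, hdiff,
    ⟨_, ⟨0, flow_zero Γ _⟩, ⟨m, s, by linarith, by linarith, g, hgy, by rw [mul_assoc]⟩, ?_, ?_⟩,
    hact, ?_⟩
  · intro h
    rw [← hgy] at h
    obtain ⟨γ, hγ, h⟩ := proj_eq_proj_iff.1 h.symm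
    have h1 : γ = 1 := by
      refine hσ₀.eq_of_dG_le hγ Γ.one_mem (g := g) ?_
      rw [← h, one_mul, dG_comm, dG_mul_self_left]
      linarith [dG_one_c_mul_b_le m s]
    rw [h1, one_mul] at h
    have h2 : c m * b s = c 0 * b 0 := by
      rw [mul_eq_left.1 h, c_zero, b_zero, one_mul]
    exact hs0 (section_ext h2).2
  · intro h
    rw [hzg] at h
    obtain ⟨γ, hγ, h⟩ := proj_eq_proj_iff.1 h.symm
    rw [mul_assoc g (c u₁)] at h
    have h1 : γ = 1 := by
      refine hσ₀.eq_of_dG_le hγ Γ.one_mem (g := g * (c u₁ * b s₁)) ?_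
      rw [← h, one_mul]
      have k1 : dG (g * (c m * b s)) g ≤ |m| + |s| := by
        rw [dG_comm, dG_mul_self_left]
        exact dG_one_c_mul_b_le m s
      have k2 : dG g (g * (c u₁ * b s₁)) ≤ |u₁| + |s₁| := by
        rw [dG_mul_self_left]
        exact dG_one_c_mul_b_le u₁ s₁
      linarith [dG_triangle (g * (c m * b s)) g (g * (c u₁ * b s₁))]
    rw [h1, one_mul] at h
    have h2 := (section_ext (mul_left_cancel h)).1
    rw [h2] at hm
    have : 0 < ε * Real.exp (-T₂) := by positivity
    linarith
  · intro hεs T'' O'' hO'' hdiff''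
    have e₁ : dG 1 (c u₁ * b s₁) ≤ 2 * ε := by linarith [dG_one_c_mul_b_le u₁ s₁]
    have e₂ : dG 1 (c u₂ * b s₂) ≤ 2 * ε := by linarith [dG_one_c_mul_b_le u₂ s₂]
    rw [hxg, ← hgy, hzg', hwg'] at hdiff hdiff''
    obtain ⟨h', hO', hh'⟩ := exists_lift_of_differsInBoth hσ (by linarith) hT₁ hT₂ hT₃ hT₄ hA hB hC
      e₁ e₂ hAg hBg hCg hper hdiff
    obtain ⟨h'', rfl, hh''⟩ := exists_lift_of_differsInBoth hσ (by linarith) hT₁ hT₂ hT₃ hT₄ hA hB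
      hC e₁ e₂ hAg hBg hCg hO'' hdiff''
    rw [hO']
    exact (orbit_eq_of_mul_eq_mul_a Γ hO''.1 hper.1 hh'' hh').symm
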